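/- **Setting.** Let $\Omega\subset\mathbb R^n$ be a bounded Lipschitz domain and $\mathcal T_h$ a finite partition of $\Omega$ into non-overlapping Lipschitz subdomains $K$. $L^2\Lambda(K)$ denotes square-integrable differential forms (of all degrees) on $K$, $d$ and $\delta$ are the weak exterior differential and codifferential, $\mathrm D=d+\delta$, and $w^{\rm tan},w^{\rm nor}$ are the weak tangential and normal traces on $\partial K$, so that $(dw,v)_K-(w,\delta v)_K=\langle w^{\rm tan},v^{\rm nor}\rangle_{\partial K}$. Choose linear subspaces $W_h(K)\subset H\Lambda(K)\cap H^*\Lambda(K)$ whose elements have both traces in $L^2\Lambda(\partial K)$, and linear subspaces $\widehat W_h^{\rm nor}(\partial K),\widehat W_h^{\rm tan}(\partial K)\subset L^2\Lambda(\partial K)$; let $W_h,\widehat W_h^{\rm nor},\widehat W_h^{\rm tan}$ be the products over $K\in\mathcal T_h$. Let $\widehat V_h^{\rm tan}\subset\widehat W_h^{\rm tan}$ be the subspace of elements that are single-valued on the interior skeleton, and $\mathring{\widehat V}{}_h^{\rm tan}\subset\widehat V_h^{\rm tan}$ the subspace of those that moreover vanish on $\partial\Omega$. Boldface denotes tensor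 products with $\mathbb R^2$; elements are written $\mathbf w=(q,p)$ and $\mathbf J(q,p)=(-p,q)$; $\mathbf D=\mathrm D$ componentwise. A pair of broken traces is $\widehat{\mathbf w}=(\widehat{\mathbf w}^{\rm nor},\widehat{\mathbf w}^{\rm tan})$, and $$[\mathbf w_1,\mathbf w_2]_{\partial K}=\langle\mathbf w_1^{\rm tan},\mathbf w_2^{\rm nor}\rangle_{\partial K}-\langle\mathbf w_2^{\rm tan},\mathbf w_1^{\rm nor}\rangle_{\partial K},$$ also when one or both arguments are replaced by hatted traces. Subscripts $\mathcal T_h$ and $\partial\mathcal T_h$ denote sums over $K$ of the corresponding quantities on $K$ and $\partial K$. Let $\boldsymbol\Phi_K:\mathbf W_h(K)\times\widehat{\mathbf W}_h^{\rm nor}(\partial K)\times\widehat{\mathbf W}_h^{\rm tan}(\partial K)\to\mathbf L^2\boldsymbol\Lambda(\partial K)$ be bounded linear maps (the local flux function $\boldsymbol\Phi$), let $I\subset\mathbb R$ be a set of times, and let $\mathbf f_K:I\times\mathbf W_h(K)\to\mathbf L^2\boldsymbol\Lambda(K)$ be local source terms, $C^1$ in the second variable; $\mathbf f=\prod_K\mathbf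 f_K$. Consider the semidiscrete weak problem $$(\mathbf J\dot{\mathbf z}_h,\mathbf w_h)_{\mathcal T_h}+(\mathbf z_h,\mathbf D\mathbf w_h)_{\mathcal T_h}+[\widehat{\mathbf z}_h,\mathbf w_h]_{\partial\mathcal T_h}=(\mathbf f(t,\mathbf z_h),\mathbf w_h)_{\mathcal T_h}\quad\forall\,\mathbf w_h\in\mathbf W_h,\tag{1}$$ $$\langle\boldsymbol\Phi(\mathbf z_h,\widehat{\mathbf z}_h),\widehat{\mathbf w}_h^{\rm nor}\rangle_{\partial\mathcal T_h}=0\quad\forall\,\widehat{\mathbf w}_h^{\rm nor}\in\widehat{\mathbf W}_h^{\rm nor},\tag{2}$$ $$\langle\widehat{\mathbf z}_h^{\rm nor},\widehat{\mathbf w}_h^{\rm tan}\rangle_{\partial\mathcal T_h}=0\quad\forall\,\widehat{\mathbf w}_h^{\rm tan}\in\mathring{\widehat{\mathbf V}}{}_h^{\rm tan}.\tag{3}$$ The flux $\boldsymbol\Phi$ is *multisymplectic* if $[\widehat{\mathbf w}_1-\mathbf w_1,\widehat{\mathbf w}_2-\mathbf w_2]_{\partial K}=0$ for every $K$ whenever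 $(\mathbf w_i,\widehat{\mathbf w}_i)\in\mathbf W_h\times\widehat{\mathbf W}_h^{\rm nor}\times\widehat{\mathbf V}_h^{\rm tan}$, $i=1,2$, satisfy (2). **Reduction.** Let $\widetilde W_h$ be a finite-dimensional real inner product space, $\widetilde{\mathbf W}_h=\widetilde W_h\otimes\mathbb R^2$, $\widetilde{\mathbf J}(\widetilde q,\widetilde p)=(-\widetilde p,\widetilde q)$. Let $$\boldsymbol\Theta:I\times\widetilde{\mathbf W}_h\to\mathbf W_h\times\widehat{\mathbf W}_h^{\rm nor}\times\mathring{\widehat{\mathbf V}}{}_h^{\rm tan},\qquad(t,\widetilde{\mathbf z}_h)\mapsto(\mathbf z_h,\widehat{\mathbf z}_h),$$ be differentiable in $\widetilde{\mathbf z}_h$ and such that: (a) $\widetilde{\mathbf z}_h\mapsto\mathbf z_h$ does not depend on $t$ and is symplectic, i.e. $(\mathbf J\mathbf w_1,\mathbf w_2)_{\mathcal T_h}=(\widetilde{\mathbf J}\widetilde{\mathbf w}_1,\widetilde{\mathbf w}_2)$ for $\mathbf w_i=\frac{\partial\mathbf z_h}{\partial\widetilde{\mathbf z}_h}\widetilde{\mathbf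 w}_i$; (b) for $\dot{\mathbf z}_h=\frac{\partial\mathbf z_h}{\partial\widetilde{\mathbf z}_h}\dot{\widetilde{\mathbf z}}_h$ with any $\dot{\widetilde{\mathbf z}}_h\in\widetilde{\mathbf W}_h$, if (1) holds for all test functions of the form $\mathbf w_h=\frac{\partial\mathbf z_h}{\partial\widetilde{\mathbf z}_h}\widetilde{\mathbf w}_h$, then it holds for all $\mathbf w_h\in\mathbf W_h$; (c) $(\mathbf z_h,\widehat{\mathbf z}_h)$ satisfies (2) and (3). Define $\widetilde{\mathbf f}(t,\widetilde{\mathbf z}_h)\in\widetilde{\mathbf W}_h$ by $$(\widetilde{\mathbf f}(t,\widetilde{\mathbf z}_h),\widetilde{\mathbf w}_h)=(\mathbf f(t,\mathbf z_h),\mathbf w_h)_{\mathcal T_h}-(\mathbf z_h,\mathbf D\mathbf w_h)_{\mathcal T_h}-[\widehat{\mathbf z}_h,\mathbf w_h]_{\partial\mathcal T_h},\qquad\mathbf w_h=\tfrac{\partial\mathbf z_h}{\partial\widetilde{\mathbf z}_h}\widetilde{\mathbf w}_h,$$ so that the semidiscretization becomes the ODE $\widetilde{\mathbf J}\dot{\widetilde{\mathbf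 z}}_h=\widetilde{\mathbf f}(t,\widetilde{\mathbf z}_h)$. For tangent vectors $\widetilde{\mathbf w}_i$ at $(t,\widetilde{\mathbf z}_h)$ put $(\mathbf w_i,\widehat{\mathbf w}_i)=\frac{\partial\boldsymbol\Theta}{\partial\widetilde{\mathbf z}_h}\widetilde{\mathbf w}_i$. For $K\in\mathcal T_h$, consider the augmented system in $(\widetilde{\mathbf z}_h,\widetilde{\mathbf w}_1,\widetilde{\mathbf w}_2,\zeta)\in(\widetilde{\mathbf W}_h)^3\times\mathbb R$ $$\widetilde{\mathbf J}\dot{\widetilde{\mathbf z}}_h=\widetilde{\mathbf f}(t,\widetilde{\mathbf z}_h),\quad\widetilde{\mathbf J}\dot{\widetilde{\mathbf w}}_i=\frac{\partial\widetilde{\mathbf f}}{\partial\widetilde{\mathbf z}_h}\widetilde{\mathbf w}_i\ (i=1,2),\quad\dot\zeta=-[\widehat{\mathbf w}_1,\widehat{\mathbf w}_2]_{\partial K}.\tag{4}$$ **Time integrators.** An $s$-stage Runge–Kutta (RK) method with coefficients $a_{ij},b_i,c_i$ takes $x^0$ at time $t^0$ to $x^1=x^0+\Delta t\sum_ib_iF(T^i,X^i)$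 for $\dot x=F(t,x)$, where $T^i=t^0+c_i\Delta t$ and the stages satisfy $X^i=x^0+\Delta t\sum_ja_{ij}F(T^j,X^j)$. A partitioned Runge–Kutta (PRK) method with coefficients $(a_{ij},b_i,c_i)$ and $(\bar a_{ij},\bar b_i,\bar c_i)$ uses the first coefficients for the first part and the second coefficients for the second part of a partitioned system. For $\widetilde{\mathbf f}$ the parts are $\widetilde q_h$ and $\widetilde p_h$, where $\widetilde{\mathbf z}_h=(\widetilde q_h,\widetilde p_h)$; in (4) all three copies of $\widetilde{\mathbf W}_h$ are partitioned in this way, and $\zeta$ is put in the first part. The conditions for symplecticity are $$b_ib_j-b_ia_{ij}-b_ja_{ji}=0\quad\forall i,j,\tag{srk}$$ $$b_i\bar b_j-b_i\bar a_{ij}-\bar b_ja_{ji}=0\quad\forall i,j,\qquad b_i=\bar b_i,\quad c_i=\bar c_i\quad\forall i.\tag{sprk}$$ **Theorem.** Suppose that $\partial\mathbf f/\partial\mathbf z_h$ is symmetric with respect to $(\cdot,\cdot)_{\mathcal T_h}$ and that $\boldsymbol\Phi$ is multisymplectic. Let $t^0$, $t^1=t^0+\Delta t$ and all $T^i$ belong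 to $I$. Suppose that either (i) the map $\widetilde{\mathbf z}_h\mapsto\mathbf z_h$ is linear, and the integrator is an RK method satisfying (srk); or (ii) the map $\widetilde{\mathbf z}_h\mapsto\mathbf z_h$ partitions into linear maps $\widetilde q_h\mapsto q_h$ and $\widetilde p_h\mapsto p_h$, the flux partitions as $\boldsymbol\Phi(\mathbf z_h,\widehat{\mathbf z}_h)=(\Phi_q(q_h,\widehat q_h),\Phi_p(p_h,\widehat p_h))$, and the integrator is a PRK method satisfying (sprk). Let $K\in\mathcal T_h$ and $\widetilde{\mathbf z}_h^0,\widetilde{\mathbf w}_1^0,\widetilde{\mathbf w}_2^0\in\widetilde{\mathbf W}_h$. (A) For every step of the method applied to (4) from $\bigl(\widetilde{\mathbf z}_h^0,\widetilde{\mathbf w}_1^0,\widetilde{\mathbf w}_2^0,(\mathbf J\mathbf w_1^0,\mathbf w_2^0)_K\bigr)$, with any solution of the stage equations, the result is $\bigl(\widetilde{\mathbf z}_h^1,\widetilde{\mathbf w}_1^1,\widetilde{\mathbf w}_2^1,\zeta^1\bigr)$ with $\zeta^1=(\mathbf J\mathbf w_1^1,\mathbf w_2^1)_K$, and $$(\mathbf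 J\mathbf w_1^1,\mathbf w_2^1)_K=(\mathbf J\mathbf w_1^0,\mathbf w_2^0)_K-\Delta t\sum_{i=1}^sb_i[\widehat{\mathbf W}_1^i,\widehat{\mathbf W}_2^i]_{\partial K},\tag{5}$$ where $(\mathbf W_k^i,\widehat{\mathbf W}_k^i)=\frac{\partial\boldsymbol\Theta}{\partial\widetilde{\mathbf z}_h}(T^i,\widetilde{\mathbf Z}_h^i)\,\widetilde{\mathbf W}_k^i$ and $\widetilde{\mathbf Z}_h^i,\widetilde{\mathbf W}_k^i$ are the stages of $\widetilde{\mathbf z}_h,\widetilde{\mathbf w}_k$. (B) Suppose that the stage equations of the method for $\widetilde{\mathbf f}$ are solved, for all initial values in a neighbourhood of $\widetilde{\mathbf z}_h^0$, by stages that depend on the initial value differentiably at $\widetilde{\mathbf z}_h^0$; let $\Psi_{\widetilde{\mathbf f}}$ be the resulting numerical flow, and let $\widetilde{\mathbf z}_h^1=\Psi_{\widetilde{\mathbf f}}(t^0,\widetilde{\mathbf z}_h^0)$, $\widetilde{\mathbf w}_k^1=\frac{\partial\widetilde{\mathbf z}_h^1}{\partial\widetilde{\mathbf z}_h^0}\widetilde{\mathbf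 w}_k^0$, $k=1,2$. Then $\bigl(\widetilde{\mathbf z}_h^1,\widetilde{\mathbf w}_1^1,\widetilde{\mathbf w}_2^1,(\mathbf J\mathbf w_1^1,\mathbf w_2^1)_K\bigr)$ is the result of a step of the same method applied to (4) from $\bigl(\widetilde{\mathbf z}_h^0,\widetilde{\mathbf w}_1^0,\widetilde{\mathbf w}_2^0,(\mathbf J\mathbf w_1^0,\mathbf w_2^0)_K\bigr)$, whose stages are the given stages $\widetilde{\mathbf Z}_h^i$, the derivatives $\widetilde{\mathbf W}_k^i=\frac{\partial\widetilde{\mathbf Z}_h^i}{\partial\widetilde{\mathbf z}_h^0}\widetilde{\mathbf w}_k^0$, and suitable stages of $\zeta$; and the discrete multisymplectic conservation law (5) holds with these stages. -/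

import Mathlib

open MeasureTheory Filter Topology
open scoped ContDiff

noncomputable section

namespace MultisymplecticFEEC

/-! ### Exterior algebra on `ℝⁿ` -/

/-- Euclidean space `ℝⁿ`. -/
abbrev Eucl (n : ℕ) : Type := EuclideanSpace ℝ (Fin n)

/-- `Alt ℝⁿ = ⨁ₖ Altᵏ ℝⁿ` with its Euclidean inner product, in the orthonormal basis
`dx^I = dx^{i₁} ∧ ⋯ ∧ dx^{iₖ}`, `I = {i₁ < ⋯ < iₖ}`: the form `∑_I w_I dx^I` is the family of its
coefficients `w_I`. -/
abbrev Alt (n : ℕ) : Type := EuclideanSpace ℝ (Finset (Fin n))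

/-- The sign `ε` with `dx^j ∧ dx^{I \ {j}} = ε dx^{I ∪ {j}}`. -/
def wedgeSign {n : ℕ} (j : Fin n) (I : Finset (Fin n)) : ℝ :=
  (-1) ^ (I.filter (· < j)).card

/-- Exterior product `v ∧ w` of the covector `v` (identified with a vector) and the form `w`. -/
def covWedge {n : ℕ} (v : Eucl n) (w : Alt n) : Alt n :=
  WithLp.toLp 2 fun I => ∑ j ∈ I, wedgeSign j I * v j * w (I.erase j)

/-- Interior product `ι_v w` (contraction of the form `w` with the vector `v`). -/
def contract {n : ℕ} (v : Eucl n) (w : Alt n) : Alt n :=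
  WithLp.toLp 2 fun I => ∑ j ∈ Iᶜ, wedgeSign j I * v j * w (insert j I)

/-- The interior product is the adjoint of the exterior product with the same covector. -/
theorem inner_covWedge {n : ℕ} (v : Eucl n) (w u : Alt n) :
    inner ℝ (covWedge v w) u = inner ℝ w (contract v u) := by
  simp only [covWedge, contract, PiLp.inner_apply, RCLike.inner_apply, conj_trivial,
    Finset.mul_sum, Finset.sum_mul]
  rw [Finset.sum_sigma', Finset.sum_sigma']
  refine Finset.sum_bij' (fun p _ => ⟨p.1.erase p.2, p.2⟩) (fun p _ => ⟨insert p.2 p.1, p.2⟩)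
    ?_ ?_ ?_ ?_ ?_
  · rintro ⟨I, j⟩ h
    simp
  · rintro ⟨I, j⟩ h
    simp
  · rintro ⟨I, j⟩ h
    simp only [Finset.mem_sigma, Finset.mem_univ, true_and] at h
    simp [Finset.insert_erase h]
  · rintro ⟨I, j⟩ h
    simp only [Finset.mem_sigma, Finset.mem_univ, true_and, Finset.mem_compl] at h
    simp [Finset.erase_insert h]
  · rintro ⟨I, j⟩ h
    simp only [Finset.mem_sigma, Finset.mem_univ, true_and] at h
    have hs : wedgeSign j (I.erase j) = wedgeSign j I := by
      unfold wedgeSign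
      congr 2
      ext i
      simp only [Finset.mem_filter, Finset.mem_erase]
      constructor
      · rintro ⟨⟨_, h2⟩, h3⟩
        exact ⟨h2, h3⟩
      · rintro ⟨h2, h3⟩
        exact ⟨⟨ne_of_lt h3, h2⟩, h3⟩
    simp only [hs, Finset.insert_erase h]
    ring

theorem contract_add {n : ℕ} (v : Eucl n) (w u : Alt n) :
    contract v (w + u) = contract v w + contract v u := by
  ext I
  simp [contract, mul_add, Finset.sum_add_distrib]

theorem contract_smul {n : ℕ} (v : Eucl n) (c : ℝ) (w : Alt n) :
    contract v (c • w) = c • contract v w := by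
  ext I
  simp only [contract, PiLp.smul_apply, smul_eq_mul, Finset.mul_sum]
  exact Finset.sum_congr rfl fun j _ => by ring

theorem contract_zero {n : ℕ} (v : Eucl n) : contract v (0 : Alt n) = 0 := by
  ext I
  simp [contract]

/-! ### Exterior calculus -/

/-- Exterior differential `dφ = ∑ⱼ dxʲ ∧ ∂ⱼφ` of a smooth form. -/
def extD {n : ℕ} (φ : Eucl n → Alt n) (x : Eucl n) : Alt n :=
  ∑ j : Fin n, covWedge (EuclideanSpace.single j 1)
    (fderiv ℝ φ x (EuclideanSpace.single j 1))

/-- Codifferential `δφ = -∑ⱼ ι_{eⱼ} ∂ⱼφ` of a smooth form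
(on `k`-forms this is `(-1)ᵏ ⋆⁻¹ d ⋆`). -/
def coD {n : ℕ} (φ : Eucl n → Alt n) (x : Eucl n) : Alt n :=
  -∑ j : Fin n, contract (EuclideanSpace.single j 1)
    (fderiv ℝ φ x (EuclideanSpace.single j 1))

/-- `L²Λ(K)`. -/
abbrev L2 {n : ℕ} (K : Set (Eucl n)) : Type := Lp (Alt n) 2 (volume.restrict K)

/-- `g = dw` on the open set `K` in the sense of distributions. -/
def IsWeakD {n : ℕ} {K : Set (Eucl n)} (w g : L2 K) : Prop :=
  ∀ φ : Eucl n → Alt n, ContDiff ℝ ∞ φ → HasCompactSupport φ → tsupport φ ⊆ K →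
    ∫ x in K, inner ℝ (g x) (φ x) = ∫ x in K, inner ℝ (w x) (coD φ x)

/-- `g = δw` on the open set `K` in the sense of distributions. -/
def IsWeakCoD {n : ℕ} {K : Set (Eucl n)} (w g : L2 K) : Prop :=
  ∀ φ : Eucl n → Alt n, ContDiff ℝ ∞ φ → HasCompactSupport φ → tsupport φ ⊆ K →
    ∫ x in K, inner ℝ (g x) (φ x) = ∫ x in K, inner ℝ (w x) (extD φ x)

/-! ### Lipschitz domains and boundary forms -/

/-- Bounded Lipschitz domain: a bounded open set which near each of its boundary points is, in
suitable orthonormal coordinates, the strict subgraph of a Lipschitz function. (Connectedness is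
not required.) -/
def IsLipschitzDomain {n : ℕ} (K : Set (Eucl n)) : Prop :=
  IsOpen K ∧ Bornology.IsBounded K ∧
    ∀ x ∈ frontier K, ∃ (e : Eucl n) (C : NNReal) (γ : Eucl n → ℝ),
      ‖e‖ = 1 ∧ LipschitzWith C γ ∧
        ∀ᶠ y in 𝓝 x, (y ∈ K ↔ inner ℝ y e < γ (y - inner ℝ y e • e))

/-- `ν` is the outer unit normal of `K` at `x`: `K` is tangent at `x` to the half-space
`{y | ⟪y - x, ν⟫ < 0}`. There is at most one such `ν`; for a Lipschitz domain it exists at almost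
every boundary point, by Rademacher's theorem. -/
def IsOuterNormal {n : ℕ} (K : Set (Eucl n)) (x ν : Eucl n) : Prop :=
  ‖ν‖ = 1 ∧ ∀ ε > 0, ∀ᶠ y in 𝓝 x,
    (y ∈ K → inner ℝ (y - x) ν ≤ ε * ‖y - x‖) ∧ (y ∉ K → -(ε * ‖y - x‖) ≤ inner ℝ (y - x) ν)

/-- Surface measure on `∂K`. -/
def surf {n : ℕ} (K : Set (Eucl n)) : Measure (Eucl n) :=
  (Measure.euclideanHausdorffMeasure (n - 1)).restrict (frontier K)

/-- `L²Λ(∂K)` as a space of `Alt ℝⁿ`-valued functions: a form on the tangent space of `∂K` at `x` is identified with the form on `ℝⁿ`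
that restricts to it and whose contraction with the normal vanishes. -/
def tangentialForms {n : ℕ} (K : Set (Eucl n)) : Submodule ℝ (Lp (Alt n) 2 (surf K)) where
  carrier := {u | ∀ᵐ x ∂(surf K), ∀ ν, IsOuterNormal K x ν → contract ν (u x) = 0}
  zero_mem' := by
    have h := Lp.coeFn_zero (Alt n) 2 (surf K)
    filter_upwards [h] with x hx ν _
    rw [hx]
    exact contract_zero ν
  add_mem' := by
    intro u v hu hv
    have h := Lp.coeFn_add u v
    rw [Set.mem_ofPred_eq] at hu hv ⊢
    filter_upwards [h, hu, hv] with x hx h1 h2 ν hν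
    rw [hx, Pi.add_apply, contract_add, h1 ν hν, h2 ν hν, add_zero]
  smul_mem' := by
    intro c u hu
    have h := Lp.coeFn_smul c u
    rw [Set.mem_ofPred_eq] at hu ⊢
    filter_upwards [h, hu] with x hx h1 ν hν
    rw [hx, Pi.smul_apply, contract_smul, h1 ν hν, smul_zero]

/-- `L²Λ(∂K)`, as a Hilbert space. -/
def L2Bd {n : ℕ} (K : Set (Eucl n)) : Type := tangentialForms K

namespace L2Bd
variable {n : ℕ} {K : Set (Eucl n)}

instance : NormedAddCommGroup (L2Bd K) := inferInstanceAs (NormedAddCommGroup (tangentialForms K))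

instance : InnerProductSpace ℝ (L2Bd K) := inferInstanceAs (InnerProductSpace ℝ (tangentialForms K))

/-- The inclusion into the square integrable `Alt ℝⁿ`-valued functions on `∂K`. -/
def toLp : L2Bd K →ₗ[ℝ] Lp (Alt n) 2 (surf K) := (tangentialForms K).subtype

/-- A representative function. -/
def fn (u : L2Bd K) : Eucl n → Alt n := toLp u

end L2Bd

/-- `h` is the (weak) normal trace `w^nor` of `w`, where `δw = g`:
`(dφ, w)_K - (φ, δw)_K = ⟨φ^tan, w^nor⟩_∂K` for all smooth forms `φ`. As `h` is tangential,
`⟨φ^tan, h⟩_∂K` is the integral of `(φ, h)` over `∂K`. -/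
def HasNorTrace {n : ℕ} {K : Set (Eucl n)} (w g : L2 K) (h : L2Bd K) : Prop :=
  ∀ φ : Eucl n → Alt n, ContDiff ℝ ∞ φ →
    (∫ x in K, inner ℝ (extD φ x) (w x)) - ∫ x in K, inner ℝ (φ x) (g x)
      = ∫ x, inner ℝ (φ x) (h.fn x) ∂(surf K)

/-- `h` is the (weak) tangential trace `w^tan` of `w`, where `dw = g`: extension by continuity of
the tangential trace of forms `φ` that are smooth up to the boundary, i.e. `φₘ → w` and `dφₘ → dw`
in `L²Λ(K)` and `φₘ^tan ⇀ w^tan` in `L²Λ(∂K)` for a sequence of such forms. (As smooth forms are a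
linear space, weak convergence of the traces gives the same notion as strong convergence.) -/
def HasTanTrace {n : ℕ} {K : Set (Eucl n)} (w g : L2 K) (h : L2Bd K) : Prop :=
  ∃ φ : ℕ → Eucl n → Alt n, (∀ m, ContDiff ℝ ∞ (φ m)) ∧
    Tendsto (fun m => eLpNorm (fun x => φ m x - w x) 2 (volume.restrict K)) atTop (𝓝 0) ∧
    Tendsto (fun m => eLpNorm (fun x => extD (φ m) x - g x) 2 (volume.restrict K)) atTop (𝓝 0) ∧
    ∀ u : L2Bd K,
      Tendsto (fun m => ∫ x, inner ℝ (φ m x) (u.fn x) ∂(surf K)) atTop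
        (𝓝 (inner ℝ h u))

/-- Tuples `(w, dw, δw, w^tan, w^nor)`. -/
def Jet {n : ℕ} (K : Set (Eucl n)) : Type := L2 K × L2 K × L2 K × L2Bd K × L2Bd K

namespace Jet
variable {n : ℕ} {K : Set (Eucl n)}

instance : NormedAddCommGroup (Jet K) :=
  inferInstanceAs (NormedAddCommGroup (L2 K × L2 K × L2 K × L2Bd K × L2Bd K))

instance : NormedSpace ℝ (Jet K) :=
  inferInstanceAs (NormedSpace ℝ (L2 K × L2 K × L2 K × L2Bd K × L2Bd K))

/-- `w`. -/
def val : Jet K →L[ℝ] L2 K :=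
  ContinuousLinearMap.fst ℝ (L2 K) (L2 K × L2 K × L2Bd K × L2Bd K)

/-- The last four entries. -/
def tail : Jet K →L[ℝ] L2 K × L2 K × L2Bd K × L2Bd K :=
  ContinuousLinearMap.snd ℝ (L2 K) (L2 K × L2 K × L2Bd K × L2Bd K)

/-- `dw`. -/
def d : Jet K →L[ℝ] L2 K :=
  ContinuousLinearMap.fst ℝ (L2 K) (L2 K × L2Bd K × L2Bd K) ∘L tail

/-- `δw`. -/
def δ : Jet K →L[ℝ] L2 K :=
  ContinuousLinearMap.fst ℝ (L2 K) (L2Bd K × L2Bd K) ∘L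
    ContinuousLinearMap.snd ℝ (L2 K) (L2 K × L2Bd K × L2Bd K) ∘L tail

/-- `(w^tan, w^nor)`. -/
def traces : Jet K →L[ℝ] L2Bd K × L2Bd K :=
  ContinuousLinearMap.snd ℝ (L2 K) (L2Bd K × L2Bd K) ∘L
    ContinuousLinearMap.snd ℝ (L2 K) (L2 K × L2Bd K × L2Bd K) ∘L tail

/-- `w^tan`. -/
def tan : Jet K →L[ℝ] L2Bd K := ContinuousLinearMap.fst ℝ (L2Bd K) (L2Bd K) ∘L traces

/-- `w^nor`. -/
def nor : Jet K →L[ℝ] L2Bd K := ContinuousLinearMap.snd ℝ (L2Bd K) (L2Bd K) ∘L traces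

/-- The Hodge--Dirac operator `Dw = dw + δw`. -/
def dirac : Jet K →L[ℝ] L2 K := d + δ

/-- `w ∈ HΛ(K) ∩ H*Λ(K)` with `w^tan, w^nor ∈ L²Λ(∂K)`. The form `w` is recorded together with
`dw`, `δw`, `w^tan`, `w^nor`, which it determines; so linear spaces of such forms are linear spaces
of tuples satisfying this predicate. -/
def IsAdmissible (u : Jet K) : Prop :=
  IsWeakD (val u) (d u) ∧ IsWeakCoD (val u) (δ u) ∧
    HasTanTrace (val u) (d u) (tan u) ∧ HasNorTrace (val u) (δ u) (nor u)

end Jet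

/-! ### `ℝ²`-valued objects -/

/-- `X ⊗ ℝ²`, with elements `(q, p)`. -/
abbrev Bold (X : Type*) : Type _ := X × X

namespace Bold

/-- Componentwise application of a map. -/
def map {X Y : Type*} (f : X → Y) (x : Bold X) : Bold Y := (f x.1, f x.2)

/-- Component `i` of an element of `(∏ᵢ Xᵢ) ⊗ ℝ²`. -/
def at' {ι : Type*} {X : ι → Type*} (x : Bold (∀ i, X i)) (i : ι) : Bold (X i) :=
  (x.1 i, x.2 i)

/-- Inner product on `X ⊗ ℝ²`. -/
def ip {X : Type*} [NormedAddCommGroup X] [InnerProductSpace ℝ X] (x y : Bold X) : ℝ :=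
  inner ℝ x.1 y.1 + inner ℝ x.2 y.2

/-- `J (q, p) = (-p, q)`. -/
def J {X : Type*} [Neg X] (x : Bold X) : Bold X := (-x.2, x.1)

/-- `J⁻¹ (a, b) = (b, -a)`. -/
def Jinv {X : Type*} [Neg X] (x : Bold X) : Bold X := (x.2, -x.1)

theorem J_Jinv {X : Type*} [InvolutiveNeg X] (x : Bold X) : J (Jinv x) = x := by
  simp [J, Jinv]

end Bold

/-- The bracket `[w₁, w₂]_∂K = ⟨w₁^tan, w₂^nor⟩_∂K - ⟨w₂^tan, w₁^nor⟩_∂K` of two pairs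
`(w^nor, w^tan)` of boundary forms. -/
def bracket {n : ℕ} {K : Set (Eucl n)} (a b : Bold (L2Bd K) × Bold (L2Bd K)) : ℝ :=
  Bold.ip a.2 b.1 - Bold.ip b.2 a.1

/-! ### Hybrid methods -/

/-- A bounded Lipschitz domain `Ω ⊂ ℝⁿ` with a partition into non-overlapping Lipschitz
subdomains `K i`. -/
structure Mesh (n : ℕ) (ι : Type*) where
  Ω : Set (Eucl n)
  K : ι → Set (Eucl n)
  lipschitz_Ω : IsLipschitzDomain Ω
  lipschitz_K : ∀ i, IsLipschitzDomain (K i)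
  subset_Ω : ∀ i, K i ⊆ Ω
  disjoint : Pairwise fun i j => Disjoint (K i) (K j)
  cover : Ω ⊆ ⋃ i, closure (K i)

/-- The spatial ingredients of a hybrid FEEC method: the mesh, the broken spaces and the local flux
function. -/
structure HybridFEEC (n : ℕ) (ι : Type*) extends Mesh n ι where
  /-- `W_h(K) ⊂ HΛ(K) ∩ H*Λ(K)`, with traces in `L²Λ(∂K)` -/
  W : ∀ i, Submodule ℝ (Jet (K i))
  W_admissible : ∀ i, ∀ w ∈ W i, Jet.IsAdmissible w
  /-- `Ŵ_h^nor(∂K)` -/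
  Wnor : ∀ i, Submodule ℝ (L2Bd (K i))
  /-- `Ŵ_h^tan(∂K)` -/
  Wtan : ∀ i, Submodule ℝ (L2Bd (K i))
  /-- `Φ_K`, as a function of `(w, ŵ^nor, ŵ^tan)` -/
  Φ : ∀ i, (Bold (W i) × Bold (Wnor i) × Bold (Wtan i)) →L[ℝ] Bold (L2Bd (K i))

namespace HybridFEEC

variable {n : ℕ} {ι : Type*} (M : HybridFEEC n ι)

/-- A tangential numerical trace on `∂(K i)` as an equivalence class of functions. -/
def trFun {i : ι} (u : M.Wtan i) : Eucl n → Alt n := (u : L2Bd (M.K i)).fn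

theorem trFun_zero (i : ι) : M.trFun (0 : M.Wtan i) =ᵐ[surf (M.K i)] 0 := by
  have h := Lp.coeFn_zero (Alt n) 2 (surf (M.K i))
  rwa [← map_zero (L2Bd.toLp (K := M.K i))] at h

theorem trFun_add {i : ι} (u v : M.Wtan i) :
    M.trFun (u + v) =ᵐ[surf (M.K i)] M.trFun u + M.trFun v := by
  have h := Lp.coeFn_add (L2Bd.toLp (u : L2Bd (M.K i))) (L2Bd.toLp (v : L2Bd (M.K i)))
  rwa [← map_add] at h

theorem trFun_smul {i : ι} (c : ℝ) (u : M.Wtan i) :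
    M.trFun (c • u) =ᵐ[surf (M.K i)] c • M.trFun u := by
  have h := Lp.coeFn_smul c (L2Bd.toLp (u : L2Bd (M.K i)))
  rwa [← map_smul] at h

/-- `∂K ∩ S` with surface measure. -/
def surfOn (i : ι) (S : Set (Eucl n)) : Measure (Eucl n) :=
  (Measure.euclideanHausdorffMeasure (n - 1)).restrict (frontier (M.K i) ∩ S)

theorem surfOn_ac (i : ι) (S : Set (Eucl n)) : M.surfOn i S ≪ surf (M.K i) :=
  (Measure.restrict_mono Set.inter_subset_left le_rfl).absolutelyContinuous

theorem surfOn_ac' (i j : ι) : M.surfOn i (frontier (M.K j)) ≪ surf (M.K j) :=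
  (Measure.restrict_mono Set.inter_subset_right le_rfl).absolutelyContinuous

/-- `V̂_h^tan`: the tangential numerical traces that are single-valued on the interior skeleton. -/
def Vtan : Submodule ℝ (∀ i, M.Wtan i) where
  carrier := {u | ∀ i j, M.trFun (u i) =ᵐ[M.surfOn i (frontier (M.K j))] M.trFun (u j)}
  zero_mem' := by
    intro i j
    exact ((M.surfOn_ac i _).ae_eq (M.trFun_zero i)).trans
      ((M.surfOn_ac' i j).ae_eq (M.trFun_zero j)).symm
  add_mem' := by
    intro u v hu hv i j
    exact (((M.surfOn_ac i _).ae_eq (M.trFun_add (u i) (v i))).trans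
      ((hu i j).add (hv i j))).trans
        ((M.surfOn_ac' i j).ae_eq (M.trFun_add (u j) (v j))).symm
  smul_mem' := by
    intro c u hu i j
    exact (((M.surfOn_ac i _).ae_eq (M.trFun_smul c (u i))).trans
      ((hu i j).const_smul c)).trans
        ((M.surfOn_ac' i j).ae_eq (M.trFun_smul c (u j))).symm

/-- The tangential numerical traces in `V̂_h^tan` that vanish on `∂Ω`. -/
def V0tan : Submodule ℝ (∀ i, M.Wtan i) where
  carrier := {u | u ∈ M.Vtan ∧ ∀ i, M.trFun (u i) =ᵐ[M.surfOn i (frontier M.Ω)] 0}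
  zero_mem' := by
    refine ⟨M.Vtan.zero_mem, fun i => ?_⟩
    exact (M.surfOn_ac i _).ae_eq (M.trFun_zero i)
  add_mem' := by
    rintro u v ⟨hu, hu'⟩ ⟨hv, hv'⟩
    refine ⟨M.Vtan.add_mem hu hv, fun i => ?_⟩
    refine ((M.surfOn_ac i _).ae_eq (M.trFun_add (u i) (v i))).trans ?_
    simpa using (hu' i).add (hv' i)
  smul_mem' := by
    rintro c u ⟨hu, hu'⟩
    refine ⟨M.Vtan.smul_mem c hu, fun i => ?_⟩
    refine ((M.surfOn_ac i _).ae_eq (M.trFun_smul c (u i))).trans ?_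
    simpa using (hu' i).const_smul c

/-- `𝐖_h = ∏_K 𝐖_h(K)`. -/
abbrev BW : Type _ := Bold (∀ i, M.W i)

/-- Broken numerical traces `ŵ = (ŵ^nor, ŵ^tan)`. -/
abbrev BTr : Type _ := Bold (∀ i, M.Wnor i) × Bold (∀ i, M.Wtan i)

/-- Pairs `(w, ŵ)` with `ŵ^tan` vanishing on `∂Ω` and single-valued in the interior. -/
abbrev State : Type _ := M.BW × Bold (∀ i, M.Wnor i) × Bold M.V0tan

variable {M}

/-- The broken numerical traces `ŵ` of a state `(w, ŵ)`. -/
def State.hat (x : M.State) : M.BTr := (x.2.1, Bold.map Subtype.val x.2.2)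

variable (M)

/-- `w|_K` as an element of `𝐋²𝚲(K)`. -/
def valK (w : M.BW) (i : ι) : Bold (L2 (M.K i)) := Bold.map (fun u => Jet.val u.1) (w.at' i)

/-- `(𝐃w)|_K`. -/
def diracK (w : M.BW) (i : ι) : Bold (L2 (M.K i)) := Bold.map (fun u => Jet.dirac u.1) (w.at' i)

/-- `(w^nor, w^tan)` on `∂K`. -/
def traceK (w : M.BW) (i : ι) : Bold (L2Bd (M.K i)) × Bold (L2Bd (M.K i)) :=
  (Bold.map (fun u => Jet.nor u.1) (w.at' i), Bold.map (fun u => Jet.tan u.1) (w.at' i))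

/-- `(ŵ^nor, ŵ^tan)` on `∂K`. -/
def hatK (u : M.BTr) (i : ι) : Bold (L2Bd (M.K i)) × Bold (L2Bd (M.K i)) :=
  (Bold.map Subtype.val (u.1.at' i), Bold.map Subtype.val (u.2.at' i))

/-- `Φ_K(w, ŵ)`. -/
def fluxK (w : M.BW) (u : M.BTr) (i : ι) : Bold (L2Bd (M.K i)) :=
  M.Φ i (w.at' i, u.1.at' i, u.2.at' i)

/-- `(𝐉w₁, w₂)_K`. -/
def sympK (w₁ w₂ : M.BW) (i : ι) : ℝ := Bold.ip (Bold.J (M.valK w₁ i)) (M.valK w₂ i)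

/-- `[ŵ₁, ŵ₂]_∂K`. -/
def bracketHatK (u₁ u₂ : M.BTr) (i : ι) : ℝ := bracket (M.hatK u₁ i) (M.hatK u₂ i)

/-- Local source terms `𝐟_K : I × 𝐖_h(K) → 𝐋²𝚲(K)`. -/
abbrev Source : Type _ := ∀ i, ℝ → Bold (M.W i) → Bold (L2 (M.K i))

/-- `𝐟` is `C¹` in the form variable, for each time in `I`. -/
def SourceC1 (I : Set ℝ) (f : M.Source) : Prop :=
  ∀ i, ∀ t ∈ I, ContDiff ℝ 1 (f i t)

variable [Fintype ι]

/-- `∂𝐟/∂𝐳_h` is symmetric with respect to the inner product of `𝐋²𝚲(𝒯_h)`. -/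
def SourceSymmetric (I : Set ℝ) (f : M.Source) : Prop :=
  ∀ t ∈ I, ∀ z w₁ w₂ : M.BW,
    ∑ i, Bold.ip (fderiv ℝ (f i t) (z.at' i) (w₁.at' i)) (M.valK w₂ i)
      = ∑ i, Bold.ip (M.valK w₁ i) (fderiv ℝ (f i t) (z.at' i) (w₂.at' i))

/-- The functional
`w ↦ (𝐟(t, z), w)_𝒯 - (z, 𝐃w)_𝒯 - [ẑ, w]_∂𝒯` on `𝐖_h`. -/
def residual (f : M.Source) (t : ℝ) (x : M.State) : M.BW →ₗ[ℝ] ℝ where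
  toFun w := ∑ i, (Bold.ip (f i t (x.1.at' i)) (M.valK w i)
    - Bold.ip (M.valK x.1 i) (M.diracK w i) - bracket (M.hatK x.hat i) (M.traceK w i))
  map_add' := by
    intro w w'
    rw [← Finset.sum_add_distrib]
    refine Finset.sum_congr rfl fun i _ => ?_
    simp only [Bold.ip, valK, diracK, traceK, bracket, Bold.map, Bold.at', Prod.fst_add,
      Prod.snd_add, Pi.add_apply, Submodule.coe_add, map_add, inner_add_right, inner_add_left]
    ring
  map_smul' := by
    intro c w
    rw [RingHom.id_apply, smul_eq_mul, Finset.mul_sum]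
    refine Finset.sum_congr rfl fun i _ => ?_
    simp only [Bold.ip, valK, diracK, traceK, bracket, Bold.map, Bold.at', Prod.smul_fst,
      Prod.smul_snd, Pi.smul_apply, Submodule.coe_smul, map_smul, inner_smul_right,
      real_inner_smul_left]
    ring

/-- The dynamical equation of the weak problem, tested with `w`:
`(𝐉ż, w)_𝒯 + (z, 𝐃w)_𝒯 + [ẑ, w]_∂𝒯 = (𝐟(t, z), w)_𝒯`. -/
def WeakDynamics (f : M.Source) (t : ℝ) (x : M.State) (zdot w : M.BW) : Prop :=
  ∑ i, M.sympK zdot w i + ∑ i, Bold.ip (M.valK x.1 i) (M.diracK w i)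
      + ∑ i, bracket (M.hatK x.hat i) (M.traceK w i)
    = ∑ i, Bold.ip (f i t (x.1.at' i)) (M.valK w i)

/-- The flux relation of the weak problem:
`⟨𝚽(w, ŵ), v^nor⟩_∂𝒯 = 0` for all `v^nor ∈ 𝐖̂_h^nor`. -/
def FluxRelation (w : M.BW) (u : M.BTr) : Prop :=
  ∀ v : Bold (∀ i, M.Wnor i),
    ∑ i, Bold.ip (M.fluxK w u i) (Bold.map Subtype.val (v.at' i)) = 0

/-- The conservativity relation of the weak problem: `⟨ŵ^nor, v^tan⟩_∂𝒯 = 0` for all single-valued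
`v^tan` vanishing on `∂Ω`. -/
def Conservative (u : M.BTr) : Prop :=
  ∀ v : Bold M.V0tan,
    ∑ i, Bold.ip (M.hatK u i).1 (Bold.map Subtype.val ((Bold.map Subtype.val v).at' i)) = 0

/-- The local flux function is multisymplectic: `[ŵ₁ - w₁, ŵ₂ - w₂]_∂K = 0` for all `K` and all
`(w₁, ŵ₁)`, `(w₂, ŵ₂)` in `𝐖_h × 𝐖̂_h^nor × 𝐕̂_h^tan` satisfying the flux relation. -/
def MultisymplecticFlux : Prop :=
  ∀ (w₁ w₂ : M.BW) (u₁ u₂ : M.BTr),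
    u₁.2.1 ∈ M.Vtan → u₁.2.2 ∈ M.Vtan → u₂.2.1 ∈ M.Vtan → u₂.2.2 ∈ M.Vtan →
    M.FluxRelation w₁ u₁ → M.FluxRelation w₂ u₂ →
    ∀ i, bracket (M.hatK u₁ i - M.traceK w₁ i) (M.hatK u₂ i - M.traceK w₂ i) = 0

/-- The flux function partitions: `𝚽(z, ẑ) = (Φ_q(q, q̂), Φ_p(p, p̂))`. -/
def FluxPartitions : Prop :=
  ∀ i, ∃ Φq Φp : (M.W i × M.Wnor i × M.Wtan i) → L2Bd (M.K i),
    ∀ (w : Bold (M.W i)) (a : Bold (M.Wnor i)) (b : Bold (M.Wtan i)),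
      M.Φ i (w, a, b) = (Φq (w.1, a.1, b.1), Φp (w.2, a.2, b.2))

/-! ### Reduction to a system of ordinary differential equations -/

variable {Wt : Type*} [NormedAddCommGroup Wt] [InnerProductSpace ℝ Wt] [FiniteDimensional ℝ Wt]
variable (I : Set ℝ) (f : M.Source) (Θ : ℝ → Bold Wt → M.State)

/-- The derivative `∂z_h/∂z̃_h` at `(t, z̃)`. -/
def dz (t : ℝ) (zt : Bold Wt) : Bold Wt →L[ℝ] M.BW := fderiv ℝ (fun y => (Θ t y).1) zt

/-- `𝚯 : (t, z̃_h) ↦ (z_h, ẑ_h)` reduces the weak problem with homogeneous Dirichlet conditions to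
the symplectic vector space `W̃_h ⊗ ℝ²`. -/
structure IsReduction : Prop where
  /-- `𝚯` is differentiable in `z̃_h` -/
  differentiable : ∀ t ∈ I, Differentiable ℝ (Θ t)
  /-- `z̃_h ↦ z_h` is constant in `t` -/
  const : ∀ t ∈ I, ∀ t' ∈ I, ∀ zt, (Θ t zt).1 = (Θ t' zt).1
  /-- `z̃_h ↦ z_h` is symplectic -/
  symplectic : ∀ t ∈ I, ∀ zt w₁ w₂ : Bold Wt,
    ∑ i, M.sympK (M.dz Θ t zt w₁) (M.dz Θ t zt w₂) i = Bold.ip (Bold.J w₁) w₂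
  /-- if the dynamical equation holds for all test functions coming from `W̃_h ⊗ ℝ²`, then it holds
  for all test functions -/
  dynamics : ∀ t ∈ I, ∀ zt zdot : Bold Wt,
    (∀ wt : Bold Wt, M.WeakDynamics f t (Θ t zt) (M.dz Θ t zt zdot) (M.dz Θ t zt wt)) →
      ∀ w : M.BW, M.WeakDynamics f t (Θ t zt) (M.dz Θ t zt zdot) w
  /-- the flux relation holds -/
  flux : ∀ t ∈ I, ∀ zt, M.FluxRelation (Θ t zt).1 (Θ t zt).hat
  /-- the conservativity relation holds -/
  conservative : ∀ t ∈ I, ∀ zt, M.Conservative (Θ t zt).hat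

/-- The map `z̃_h ↦ z_h` is linear. -/
def IsLinearReduction : Prop := ∀ t ∈ I, IsLinearMap ℝ fun zt => (Θ t zt).1

/-- The map `z̃_h ↦ z_h` partitions into linear maps `q̃_h ↦ q_h` and `p̃_h ↦ p_h`. -/
def IsPartitionedLinearReduction : Prop :=
  ∀ t ∈ I, ∃ Lq Lp : Wt →ₗ[ℝ] (∀ i, M.W i), ∀ zt, (Θ t zt).1 = (Lq zt.1, Lp zt.2)

/-- `𝐟̃(t, z̃) ∈ W̃_h ⊗ ℝ²`, the Riesz representative of
`w̃ ↦ (𝐟(t, z), w)_𝒯 - (z, 𝐃w)_𝒯 - [ẑ, w]_∂𝒯`, where `w = (∂z_h/∂z̃_h) w̃`. -/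
def fTilde (t : ℝ) (zt : Bold Wt) : Bold Wt :=
  let ℓ : Bold Wt →ₗ[ℝ] ℝ := M.residual f t (Θ t zt) ∘ₗ (M.dz Θ t zt : Bold Wt →ₗ[ℝ] M.BW)
  ((InnerProductSpace.toDual ℝ Wt).symm
      (LinearMap.toContinuousLinearMap (ℓ ∘ₗ LinearMap.inl ℝ Wt Wt)),
    (InnerProductSpace.toDual ℝ Wt).symm
      (LinearMap.toContinuousLinearMap (ℓ ∘ₗ LinearMap.inr ℝ Wt Wt)))

/-- The defining identity of `𝐟̃`. -/
theorem ip_fTilde (t : ℝ) (zt wt : Bold Wt) :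
    Bold.ip (M.fTilde f Θ t zt) wt = M.residual f t (Θ t zt) (M.dz Θ t zt wt) := by
  have h : wt = LinearMap.inl ℝ Wt Wt wt.1 + LinearMap.inr ℝ Wt Wt wt.2 := by simp
  conv_rhs => rw [h, map_add, map_add]
  simp [Bold.ip, fTilde]

/-- The vector field of the ordinary differential equation `𝐉̃ dz̃/dt = 𝐟̃(t, z̃)`. -/
def field (t : ℝ) (zt : Bold Wt) : Bold Wt := Bold.Jinv (M.fTilde f Θ t zt)

/-- `(𝐉w₁, w₂)_K` with `wᵢ = (∂z_h/∂z̃_h) w̃ᵢ`. -/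
def obs (i : ι) (t : ℝ) (zt w₁ w₂ : Bold Wt) : ℝ :=
  M.sympK (M.dz Θ t zt w₁) (M.dz Θ t zt w₂) i

/-- `[ŵ₁, ŵ₂]_∂K` with `(wᵢ, ŵᵢ) = (∂𝚯/∂z̃_h) w̃ᵢ`. -/
def fluxObs (i : ι) (t : ℝ) (zt w₁ w₂ : Bold Wt) : ℝ :=
  M.bracketHatK (State.hat (fderiv ℝ (Θ t) zt w₁)) (State.hat (fderiv ℝ (Θ t) zt w₂)) i

/-- The space of tuples `(z̃, w̃₁, w̃₂, ζ)`. -/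
abbrev Aug (Wt : Type*) : Type _ := Bold Wt × Bold Wt × Bold Wt × ℝ

/-- The vector field of the augmented system `𝐉̃ dz̃/dt = 𝐟̃`, `𝐉̃ dw̃ᵢ/dt = (∂𝐟̃/∂z̃_h) w̃ᵢ`,
`dζ/dt = -[ŵ₁, ŵ₂]_∂K`. -/
def augField (i : ι) (t : ℝ) (x : Aug Wt) : Aug Wt :=
  (M.field f Θ t x.1,
    Bold.Jinv (fderiv ℝ (M.fTilde f Θ t) x.1 x.2.1),
    Bold.Jinv (fderiv ℝ (M.fTilde f Θ t) x.1 x.2.2.1),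
    -M.fluxObs Θ i t x.1 x.2.1 x.2.2.1)

end HybridFEEC

/-! ### Runge--Kutta methods -/

/-- Coefficients of an `s`-stage Runge--Kutta method. -/
structure Tableau (s : ℕ) where
  a : Fin s → Fin s → ℝ
  b : Fin s → ℝ
  c : Fin s → ℝ

namespace Tableau

variable {s : ℕ}

/-- The condition for conservation of quadratic invariants. -/
def IsSymplectic (T : Tableau s) : Prop :=
  ∀ i j, T.b i * T.b j - T.b i * T.a i j - T.b j * T.a j i = 0

/-- The conditions for conservation of bilinear invariants by the partitioned method `(T, T')`. -/
def IsSymplecticPair (T T' : Tableau s) : Prop :=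
  (∀ i j, T.b i * T'.b j - T.b i * T'.a i j - T'.b j * T.a j i = 0) ∧
    (∀ i, T.b i = T'.b i) ∧ ∀ i, T.c i = T'.c i

variable {X : Type*} [AddCommGroup X] [Module ℝ X]

/-- `X¹, …, Xˢ` are internal stages of a step of the RK method for `dx/dt = F(t, x)` from `x⁰`. -/
def IsStages (T : Tableau s) (F : ℝ → X → X) (t₀ Δt : ℝ) (x₀ : X) (Xs : Fin s → X) : Prop :=
  ∀ i, Xs i = x₀ + Δt • ∑ j, T.a i j • F (t₀ + T.c j * Δt) (Xs j)

/-- The new value `x¹`. -/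
def step (T : Tableau s) (F : ℝ → X → X) (t₀ Δt : ℝ) (x₀ : X) (Xs : Fin s → X) : X :=
  x₀ + Δt • ∑ i, T.b i • F (t₀ + T.c i * Δt) (Xs i)

variable {Y : Type*} [AddCommGroup Y] [Module ℝ Y]

/-- Internal stages of a step of the PRK method `(T, T')` for a system
`dx/dt = F(t, x, y)`, `dy/dt = G(t, x, y)`. -/
def IsPStages (T T' : Tableau s) (F : ℝ → X → Y → X) (G : ℝ → X → Y → Y) (t₀ Δt : ℝ)
    (x₀ : X) (y₀ : Y) (Xs : Fin s → X) (Ys : Fin s → Y) : Prop :=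
  (∀ i, Xs i = x₀ + Δt • ∑ j, T.a i j • F (t₀ + T.c j * Δt) (Xs j) (Ys j)) ∧
    ∀ i, Ys i = y₀ + Δt • ∑ j, T'.a i j • G (t₀ + T'.c j * Δt) (Xs j) (Ys j)

/-- The new values `(x¹, y¹)`. -/
def pstep (T T' : Tableau s) (F : ℝ → X → Y → X) (G : ℝ → X → Y → Y) (t₀ Δt : ℝ)
    (x₀ : X) (y₀ : Y) (Xs : Fin s → X) (Ys : Fin s → Y) : X × Y :=
  (x₀ + Δt • ∑ i, T.b i • F (t₀ + T.c i * Δt) (Xs i) (Ys i),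
    y₀ + Δt • ∑ i, T'.b i • G (t₀ + T'.c i * Δt) (Xs i) (Ys i))

end Tableau

namespace HybridFEEC

/-! The partition of the augmented system: `(q̃, s̃₁, s̃₂, ζ)` and `(p̃, r̃₁, r̃₂)`. (As
the augmented vector field does not depend on `ζ` and `bᵢ = b̄ᵢ`, `cᵢ = c̄ᵢ` in a symplectic pair, it
does not matter to which part `ζ` is assigned.) -/

/-- The first part `(q̃, s̃₁, s̃₂, ζ)` of `(z̃, w̃₁, w̃₂, ζ)`. -/
def augFst {Wt : Type*} (x : Aug Wt) : Wt × Wt × Wt × ℝ := (x.1.1, x.2.1.1, x.2.2.1.1, x.2.2.2)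

/-- The second part `(p̃, r̃₁, r̃₂)` of `(z̃, w̃₁, w̃₂, ζ)`. -/
def augSnd {Wt : Type*} (x : Aug Wt) : Wt × Wt × Wt := (x.1.2, x.2.1.2, x.2.2.1.2)

/-- Reassemble `(z̃, w̃₁, w̃₂, ζ)` from its two parts. -/
def augMk {Wt : Type*} (x : Wt × Wt × Wt × ℝ) (y : Wt × Wt × Wt) : Aug Wt :=
  ((x.1, y.1), (x.2.1, y.2.1), (x.2.2.1, y.2.2), x.2.2.2)

end HybridFEEC

end MultisymplecticFEEC

end

noncomputable section

namespace MultisymplecticFEEC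

/-! ### Green's formula -/

section Green
variable {n : ℕ} {K : Set (Eucl n)}

/-! The law is a quadratic invariant with a source term. Since z̃ ↦ z_h is linear and independent of
t, its derivative is one fixed map `L`, and (Jw₁, w₂)_K is a fixed bilinear form of (w̃₁, w̃₂),
namely `sympForm L i`. A symplectic Runge–Kutta step changes a bilinear form by exactly Δt times the
b-weighted sum, over the stages, of its rate of change along the slopes
(`Tableau.IsSymplecticPair.bilinear_step`). It therefore suffices to know that rate pointwise, at
any (t, z̃) with t in `I` and for arbitrary tangent vectors: by `sympK_variation_add` it is -[ŵ₁,
ŵ₂]_∂K, which is also the slope of ζ. As ζ starts at the value of the form, it agrees with the form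
after the step.

The pointwise rate is the continuous multisymplectic law. Symplecticity and condition (b) turn the
reduced equation into the weak equation for all broken test functions. Because `L` is constant,
differentiating in z̃ leaves the test function fixed and produces no second derivative of z_h;
testing with a function supported on K makes the variational equation local (`sympK_variation`).
Antisymmetrizing in w₁ and w₂ cancels the source by symmetry, Green's formula turns the 𝐃 terms into
[w₁, w₂]_∂K, and multisymplecticity of the flux combines this with the mixed brackets into [ŵ₁,
ŵ₂]_∂K. Multisymplecticity applies because the flux relation is linear, hence inherited by the
variations.

In the partitioned case `L` respects q and p, and J exchanges them, so the form is a difference of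
two pairings of a first part with a second part; each of them obeys the bilinear identity.

For the numerical flow, differentiating the stage equations with respect to the initial value gives
the stage equations of the variational system. The ζ stages are explicit, since no slope depends on
ζ, so these data form a step of the augmented system and the previous result applies. -/

theorem continuous_covWedge {X : Type*} [TopologicalSpace X] (v : Eucl n) {w : X → Alt n}
    (hw : Continuous w) : Continuous fun x => covWedge v (w x) := by
  unfold covWedge
  fun_prop

theorem continuous_extD {φ : Eucl n → Alt n} (hφ : ContDiff ℝ ∞ φ) : Continuous (extD φ) := by
  unfold extD
  refine continuous_finsetSum _ fun j _ => continuous_covWedge _ ?_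
  exact (hφ.continuous_fderiv (by simp)).clm_apply continuous_const

/-- Convergence in `L²` implies convergence of the inner products with a fixed function. -/
theorem tendsto_integral_inner {φ : ℕ → Eucl n → Alt n} (hφ : ∀ m, Continuous (φ m)) (w v : L2 K)
    (h : Tendsto (fun m => eLpNorm (fun x => φ m x - w x) 2 (volume.restrict K)) atTop (𝓝 0)) :
    Tendsto (fun m => ∫ x in K, inner ℝ (φ m x) (v x)) atTop (𝓝 (inner ℝ w v)) := by
  have hm : ∀ m, AEStronglyMeasurable (φ m) (volume.restrict K) :=
    fun m => (hφ m).aestronglyMeasurable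
  -- An individual φₘ need not be square integrable on K; this holds once the distance to w is
  -- finite.
  have hev : ∀ᶠ m in atTop, MemLp (φ m) 2 (volume.restrict K) := by
    filter_upwards [h.eventually (gt_mem_nhds ENNReal.zero_lt_top)] with m hlt
    have h1 : MemLp (fun x => φ m x - w x) 2 (volume.restrict K) :=
      ⟨(hm m).sub (Lp.aestronglyMeasurable w), hlt⟩
    have h2 := h1.add (Lp.memLp w)
    refine h2.ae_eq (ae_of_all _ fun x => ?_)
    simp
  classical
  -- The value 0 only fills finitely many indices and does not affect the limit.
  let ψ : ℕ → L2 K := fun m =>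
    if hm : MemLp (φ m) 2 (volume.restrict K) then hm.toLp (φ m) else 0
  have hψ : Tendsto ψ atTop (𝓝 w) := by
    rw [Lp.tendsto_Lp_iff_tendsto_eLpNorm']
    refine h.congr' ?_
    filter_upwards [hev] with m hm
    refine eLpNorm_congr_ae ?_
    filter_upwards [hm.coeFn_toLp] with x hx
    simp only [ψ, dif_pos hm, Pi.sub_apply, hx]
  refine ((hψ.inner tendsto_const_nhds : Tendsto _ _ (𝓝 (inner ℝ w v)))).congr' ?_
  filter_upwards [hev] with m hm
  rw [MeasureTheory.L2.inner_def]
  refine integral_congr_ae ?_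
  filter_upwards [hm.coeFn_toLp] with x hx
  simp only [ψ, dif_pos hm, hx]

/-- Green's formula `(dw, v)_K - (w, δv)_K = ⟨w^tan, v^nor⟩_∂K`. -/
theorem Jet.IsAdmissible.green {w v : Jet K} (hw : w.IsAdmissible) (hv : v.IsAdmissible) :
    inner ℝ (Jet.d w) (Jet.val v) - inner ℝ (Jet.val w) (Jet.δ v)
      = inner ℝ (Jet.tan w) (Jet.nor v) := by
  obtain ⟨-, -, ⟨φ, hφ, h1, h2, h3⟩, -⟩ := hw
  obtain ⟨-, -, -, hn⟩ := hv
  have hl := (tendsto_integral_inner (fun m => continuous_extD (hφ m)) _ (Jet.val v) h2).sub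
    (tendsto_integral_inner (fun m => (hφ m).continuous) _ (Jet.δ v) h1)
  -- The definition of the normal trace of v is Green's formula for each smooth φₘ. One side
  -- converges by the L² convergence of φₘ and dφₘ, the other by the weak convergence of the
  -- tangential traces.
  refine tendsto_nhds_unique hl ((h3 (Jet.nor v)).congr fun m => ?_)
  exact (hn (φ m) (hφ m)).symm

/-- `(w, Dv)_K - (v, Dw)_K = ⟨v^tan, w^nor⟩_∂K - ⟨w^tan, v^nor⟩_∂K`. -/
theorem Jet.IsAdmissible.inner_dirac {w v : Jet K} (hw : w.IsAdmissible) (hv : v.IsAdmissible) :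
    inner ℝ (Jet.val w) (Jet.dirac v) - inner ℝ (Jet.val v) (Jet.dirac w)
      = inner ℝ (Jet.tan v) (Jet.nor w) - inner ℝ (Jet.tan w) (Jet.nor v) := by
  -- The claim is Green's formula for (v, w) minus the one for (w, v).
  have h1 := hw.green hv
  have h2 := hv.green hw
  simp only [Jet.dirac, add_apply, inner_add_right]
  rw [real_inner_comm] at h1 h2
  linarith

end Green

/-! ### Algebra of `ℝ²`-valued objects -/

namespace Bold

/-- Componentwise application of a continuous linear map. -/
def mapL {X Y : Type*} [NormedAddCommGroup X] [NormedSpace ℝ X] [NormedAddCommGroup Y]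
    [NormedSpace ℝ Y] (φ : X →L[ℝ] Y) : Bold X →L[ℝ] Bold Y := φ.prodMap φ

variable {X : Type*} [NormedAddCommGroup X] [InnerProductSpace ℝ X]

theorem ip_comm (x y : Bold X) : ip x y = ip y x := by
  simp only [ip, real_inner_comm]

/-- `x ↦ (x, y)` as a continuous linear map. -/
def ipL (y : Bold X) : Bold X →L[ℝ] ℝ := (innerSL ℝ y.1).coprod (innerSL ℝ y.2)

theorem ipL_apply (x y : Bold X) : ipL y x = ip x y := by
  simp [ipL, ip, real_inner_comm]

theorem ip_zero (x : Bold X) : ip x 0 = 0 := by simp [ip]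

theorem zero_ip (x : Bold X) : ip 0 x = 0 := by simp [ip]

theorem ip_sub (x y z : Bold X) : ip x (y - z) = ip x y - ip x z := by
  simp only [ip, Prod.fst_sub, Prod.snd_sub, inner_sub_right]; ring

theorem sub_ip (x y z : Bold X) : ip (x - y) z = ip x z - ip y z := by
  simp only [ip, Prod.fst_sub, Prod.snd_sub, inner_sub_left]; ring

theorem ip_J_comm (x y : Bold X) : ip (J x) y = -ip (J y) x := by
  simp only [ip, J, inner_neg_left]
  rw [real_inner_comm x.1 y.2, real_inner_comm x.2 y.1]
  ring

/-- `J⁻¹` as a continuous linear map. -/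
def JinvL {X : Type*} [NormedAddCommGroup X] [NormedSpace ℝ X] : Bold X →L[ℝ] Bold X :=
  (ContinuousLinearMap.snd ℝ X X).prod (-ContinuousLinearMap.fst ℝ X X)

end Bold

/-- Antisymmetry is used on [b, c], so that both mixed terms have their hatted argument first when a
and c are numerical traces. -/
theorem bracket_sub_sub {n : ℕ} {K : Set (Eucl n)} (a b c e : Bold (L2Bd K) × Bold (L2Bd K)) :
    bracket (a - b) (c - e) = bracket a c - bracket a e + bracket c b + bracket b e := by
  simp only [bracket, Prod.fst_sub, Prod.snd_sub, Bold.ip_sub, Bold.sub_ip]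
  ring

/-- `a ↦ [a, b]_∂K` as a continuous linear map. -/
def bracketL {n : ℕ} {K : Set (Eucl n)} (b : Bold (L2Bd K) × Bold (L2Bd K)) :
    (Bold (L2Bd K) × Bold (L2Bd K)) →L[ℝ] ℝ :=
  Bold.ipL b.1 ∘L ContinuousLinearMap.snd ℝ _ _ - Bold.ipL b.2 ∘L ContinuousLinearMap.fst ℝ _ _

theorem bracketL_apply {n : ℕ} {K : Set (Eucl n)} (a b : Bold (L2Bd K) × Bold (L2Bd K)) :
    bracketL b a = bracket a b := by
  simp only [bracketL, sub_apply, ContinuousLinearMap.comp_apply,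
    ContinuousLinearMap.coe_fst', ContinuousLinearMap.coe_snd', Bold.ipL_apply, bracket]
  rw [Bold.ip_comm a.1]

theorem bracket_zero {n : ℕ} {K : Set (Eucl n)} (a : Bold (L2Bd K) × Bold (L2Bd K)) :
    bracket a 0 = 0 := by
  simp [bracket, Bold.ip_zero, Bold.zero_ip]

/-! ### Bilinear invariants of partitioned Runge--Kutta methods -/

/-- Evolution of a bilinear functional under a partitioned Runge--Kutta step with slopes `F`, `G`
and stages `Q`, `P`. -/
theorem Tableau.IsSymplecticPair.bilinear_step {s : ℕ} {T T' : Tableau s}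
    (h : T.IsSymplecticPair T') {X Y : Type*} [AddCommGroup X] [Module ℝ X] [AddCommGroup Y]
    [Module ℝ Y] (B : X →ₗ[ℝ] Y →ₗ[ℝ] ℝ) (τ : ℝ) (q : X) (p : Y) (Q F : Fin s → X)
    (P G : Fin s → Y) (hQ : ∀ i, Q i = q + τ • ∑ j, T.a i j • F j)
    (hP : ∀ i, P i = p + τ • ∑ j, T'.a i j • G j) :
    B (q + τ • ∑ i, T.b i • F i) (p + τ • ∑ i, T'.b i • G i)
      = B q p + τ * ∑ i, T.b i * (B (F i) (P i) + B (Q i) (G i)) := by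
  obtain ⟨h1, h2, -⟩ := h
  -- After both sides are expanded in the slopes, the terms of order 0 and 1 in τ agree and the
  -- difference is τ² times this sum.
  have hz : ∑ i, ∑ j, (T.b i * T'.b j - T.b i * T'.a i j - T'.b j * T.a j i) * B (F i) (G j)
      = 0 := by simp [h1]
  have e1 : ∀ i, B (F i) (P i) = B (F i) p + τ * ∑ j, T'.a i j * B (F i) (G j) := by
    intro i
    simp [hP]
  have e2 : ∀ j, B (Q j) (G j) = B q (G j) + τ * ∑ i, T.a j i * B (F i) (G j) := by
    intro j
    simp [hQ, LinearMap.sum_apply]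
  -- The equality of the weights b and b̄ enters here: the symplecticity condition pairs a with b̄.
  have e3 : ∑ i, T.b i * B (Q i) (G i) = ∑ i, T.b i * B q (G i)
      + τ * ∑ i, ∑ j, T'.b j * T.a j i * B (F i) (G j) := by
    rw [Finset.sum_comm, Finset.mul_sum, ← Finset.sum_add_distrib]
    refine Finset.sum_congr rfl fun j _ => ?_
    rw [e2, h2, mul_add]
    simp only [Finset.mul_sum]
    congr 1
    exact Finset.sum_congr rfl fun i _ => by ring
  have e4 : ∑ i, T.b i * B (F i) (P i) = ∑ i, T.b i * B (F i) p
      + τ * ∑ i, ∑ j, T.b i * T'.a i j * B (F i) (G j) := by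
    rw [Finset.mul_sum, ← Finset.sum_add_distrib]
    refine Finset.sum_congr rfl fun j _ => ?_
    rw [e1, mul_add]
    simp only [Finset.mul_sum]
    congr 1
    exact Finset.sum_congr rfl fun i _ => by ring
  simp only [sub_mul, Finset.sum_sub_distrib] at hz
  simp only [mul_add, Finset.sum_add_distrib, e3, e4]
  have e5 : ∑ i, T'.b i * B q (G i) = ∑ i, T.b i * B q (G i) := by simp [h2]
  have e6 : B (q + τ • ∑ i, T.b i • F i) (p + τ • ∑ i, T'.b i • G i)
      = B q p + τ * ∑ i, T'.b i * B q (G i) + τ * ∑ i, T.b i * B (F i) p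
        + τ * τ * ∑ i, ∑ j, T.b i * T'.b j * B (F i) (G j) := by
    rw [Finset.sum_comm]
    simp only [map_add, map_smul, map_sum, LinearMap.add_apply, LinearMap.smul_apply,
      LinearMap.sum_apply, smul_eq_mul, Finset.mul_sum, mul_add, Finset.sum_add_distrib, mul_assoc]
    ring_nf
    congr 1
    exact Finset.sum_congr rfl fun i _ => Finset.sum_congr rfl fun j _ => by ring
  rw [e6, e5]
  linear_combination (τ * τ) * hz

/-- With equal tableaus the partitioned conditions reduce to the unpartitioned one, so a single
computation serves both kinds of method. -/
theorem Tableau.IsSymplectic.pair {s : ℕ} {T : Tableau s} (h : T.IsSymplectic) :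
    T.IsSymplecticPair T :=
  ⟨h, fun _ => rfl, fun _ => rfl⟩

namespace HybridFEEC

/-! ### The local balance law for variations -/

section Linear
variable {n : ℕ} {ι : Type*} (M : HybridFEEC n ι)

/-- Restriction of `w` to `K`, extended by zero. -/
def restrictTo [DecidableEq ι] (w : M.BW) (i : ι) : M.BW :=
  (Pi.single i (w.1 i), Pi.single i (w.2 i))

theorem restrictTo_at_self [DecidableEq ι] (w : M.BW) (i : ι) :
    (M.restrictTo w i).at' i = w.at' i := by
  simp [restrictTo, Bold.at']

theorem restrictTo_at_ne [DecidableEq ι] (w : M.BW) {i j : ι} (h : j ≠ i) :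
    (M.restrictTo w i).at' j = 0 := by
  simp [restrictTo, Bold.at', h]

theorem valK_of_at_eq {w v : M.BW} {i : ι} (h : w.at' i = v.at' i) :
    M.valK w i = M.valK v i := by simp only [valK, h]

theorem diracK_of_at_eq {w v : M.BW} {i : ι} (h : w.at' i = v.at' i) :
    M.diracK w i = M.diracK v i := by simp only [diracK, h]

theorem traceK_of_at_eq {w v : M.BW} {i : ι} (h : w.at' i = v.at' i) :
    M.traceK w i = M.traceK v i := by simp only [traceK, h]

theorem valK_of_at_eq_zero {w : M.BW} {i : ι} (h : w.at' i = 0) : M.valK w i = 0 := by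
  simp [valK, h, Bold.map]

theorem diracK_of_at_eq_zero {w : M.BW} {i : ι} (h : w.at' i = 0) : M.diracK w i = 0 := by
  simp [diracK, h, Bold.map]

theorem traceK_of_at_eq_zero {w : M.BW} {i : ι} (h : w.at' i = 0) : M.traceK w i = 0 := by
  simp [traceK, h, Bold.map]

/-- `(w₁, 𝐃w₂)_K - (w₂, 𝐃w₁)_K = -[w₁, w₂]_∂K`. -/
theorem ip_valK_diracK (w₁ w₂ : M.BW) (i : ι) :
    Bold.ip (M.valK w₁ i) (M.diracK w₂ i) - Bold.ip (M.valK w₂ i) (M.diracK w₁ i)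
      = -bracket (M.traceK w₁ i) (M.traceK w₂ i) := by
  have h := fun u v : M.W i =>
    (M.W_admissible i _ u.2).inner_dirac (M.W_admissible i _ v.2)
  have h1 := h (w₁.1 i) (w₂.1 i)
  have h2 := h (w₁.2 i) (w₂.2 i)
  simp only [Bold.ip, valK, diracK, traceK, bracket, Bold.map, Bold.at'] at h1 h2 ⊢
  linarith

variable {M} in
theorem sympK_symm (w₁ w₂ : M.BW) (i : ι) : M.sympK w₁ w₂ i = -M.sympK w₂ w₁ i :=
  Bold.ip_J_comm _ _

variable [Fintype ι]

/-- `w ↦ 𝐰|_K` as a continuous linear map. -/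
def atL (i : ι) : M.BW →L[ℝ] Bold (M.W i) := Bold.mapL (ContinuousLinearMap.proj i)

/-- `w ↦ w|_K` as a continuous linear map with values in `𝐋²𝚲(K)`. -/
def valL (i : ι) : M.BW →L[ℝ] Bold (L2 (M.K i)) :=
  Bold.mapL (Jet.val ∘L (M.W i).subtypeL) ∘L M.atL i

/-- `(w, ŵ) ↦ ŵ` as a continuous linear map. -/
def hatL : M.State →L[ℝ] M.BTr :=
  (Bold.mapL (ContinuousLinearMap.id ℝ _) |>.prodMap (Bold.mapL M.V0tan.subtypeL)) ∘L
    ContinuousLinearMap.snd ℝ M.BW (Bold (∀ i, M.Wnor i) × Bold M.V0tan)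

/-- `ŵ ↦ ŵ|_∂K` as a continuous linear map. -/
def hatKL (i : ι) : M.BTr →L[ℝ] Bold (L2Bd (M.K i)) × Bold (L2Bd (M.K i)) :=
  (Bold.mapL ((M.Wnor i).subtypeL ∘L ContinuousLinearMap.proj i)).prodMap
    (Bold.mapL ((M.Wtan i).subtypeL ∘L ContinuousLinearMap.proj i))

/-- `(w, ŵ) ↦ Φ_K(w, ŵ)` as a continuous linear map. -/
def fluxL (i : ι) : M.State →L[ℝ] Bold (L2Bd (M.K i)) :=
  M.Φ i ∘L ((M.atL i).prodMap
    ((Bold.mapL (ContinuousLinearMap.proj i)).prodMap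
      (Bold.mapL (ContinuousLinearMap.proj i)))) ∘L
    (ContinuousLinearMap.fst ℝ _ _).prod M.hatL

theorem valL_apply (i : ι) (w : M.BW) : M.valL i w = M.valK w i := rfl

/-- The derivative of `x ↦ residual f t x w` at `x` in direction `v`. -/
def residualDeriv (f : M.Source) (t : ℝ) (x v : M.State) (w : M.BW) : ℝ :=
  ∑ i, (Bold.ip (fderiv ℝ (f i t) (x.1.at' i) (v.1.at' i)) (M.valK w i)
    - Bold.ip (M.valK v.1 i) (M.diracK w i) - bracket (M.hatK v.hat i) (M.traceK w i))

/-- At fixed time and test function, all terms except the source are linear in the state, so only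
the source has to be differentiated. -/
theorem hasFDerivAt_residual {I : Set ℝ} {f : M.Source} (hf : M.SourceC1 I f) {t : ℝ} (ht : t ∈ I)
    (x : M.State) (w : M.BW) :
    ∃ D : M.State →L[ℝ] ℝ, HasFDerivAt (fun y => M.residual f t y w) D x ∧
      ∀ v, D v = M.residualDeriv f t x v w := by
  refine ⟨∑ i, (Bold.ipL (M.valK w i) ∘L fderiv ℝ (f i t) (x.1.at' i) ∘L M.atL i ∘L
      ContinuousLinearMap.fst ℝ _ _
    - Bold.ipL (M.diracK w i) ∘L M.valL i ∘L ContinuousLinearMap.fst ℝ _ _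
    - bracketL (M.traceK w i) ∘L M.hatKL i ∘L M.hatL), ?_, fun v => ?_⟩
  · have h : (fun y : M.State => M.residual f t y w) = fun y => ∑ i,
        (Bold.ipL (M.valK w i) (f i t (M.atL i y.1))
          - (Bold.ipL (M.diracK w i) ∘L M.valL i ∘L ContinuousLinearMap.fst ℝ _ _) y
          - (bracketL (M.traceK w i) ∘L M.hatKL i ∘L M.hatL) y) := by
      funext y
      refine Finset.sum_congr rfl fun i _ => ?_
      simp only [Bold.ipL_apply, ContinuousLinearMap.comp_apply, bracketL_apply]
      rfl
    rw [h]
    refine HasFDerivAt.fun_sum fun i _ => ?_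
    refine HasFDerivAt.sub (HasFDerivAt.sub ?_ (ContinuousLinearMap.hasFDerivAt _))
      (ContinuousLinearMap.hasFDerivAt _)
    refine (Bold.ipL (M.valK w i)).hasFDerivAt.comp x ?_
    have h1 : HasFDerivAt (f i t) (fderiv ℝ (f i t) (x.1.at' i)) (x.1.at' i) :=
      ((hf i t ht).differentiable (by simp)).differentiableAt.hasFDerivAt
    have h2 : HasFDerivAt (fun y : M.State => M.atL i y.1)
        (M.atL i ∘L ContinuousLinearMap.fst ℝ M.BW _) x :=
      HasFDerivAt.comp x (M.atL i).hasFDerivAt hasFDerivAt_fst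
    exact HasFDerivAt.comp x (g := f i t) h1 h2
  · simp only [residualDeriv, sum_apply, sub_apply,
      ContinuousLinearMap.comp_apply, Bold.ipL_apply, bracketL_apply]
    rfl

/-- The flux relation is linear and closed, hence satisfied by derivatives. -/
theorem fluxRelation_fderiv {X : Type*} [NormedAddCommGroup X] [NormedSpace ℝ X] {g : X → M.State}
    (hg : Differentiable ℝ g) (h : ∀ y, M.FluxRelation (g y).1 (g y).hat) (y v : X) :
    M.FluxRelation (fderiv ℝ g y v).1 (State.hat (fderiv ℝ g y v)) := by
  intro b
  let A : M.State →L[ℝ] ℝ := ∑ i, Bold.ipL (Bold.map Subtype.val (b.at' i)) ∘L M.fluxL i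
  have hA : ∀ x : M.State, A x
      = ∑ i, Bold.ip (M.fluxK x.1 x.hat i) (Bold.map Subtype.val (b.at' i)) := by
    intro x
    simp only [A, sum_apply, ContinuousLinearMap.comp_apply, Bold.ipL_apply]
    rfl
  have h0 : (fun z => A (g z)) = fun _ => 0 := by
    funext z
    rw [hA]
    exact h z b
  have h1 : HasFDerivAt (fun z => A (g z)) (A ∘L fderiv ℝ g y) y :=
    A.hasFDerivAt.comp y (hg y).hasFDerivAt
  rw [h0] at h1
  have h2 := h1.unique (hasFDerivAt_const (0 : ℝ) y)
  rw [← hA]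
  exact DFunLike.congr_fun h2 v

/-- This is the expansion of [ŵ₁ - w₁, ŵ₂ - w₂]_∂K = 0. The hypothesis on the flux applies because
traces that vanish on ∂Ω are in particular single-valued. -/
theorem bracketHatK_of_multisymplectic (hΦ : M.MultisymplecticFlux) {x₁ x₂ : M.State}
    (h₁ : M.FluxRelation x₁.1 x₁.hat) (h₂ : M.FluxRelation x₂.1 x₂.hat) (i : ι) :
    M.bracketHatK x₁.hat x₂.hat i
      = bracket (M.hatK x₁.hat i) (M.traceK x₂.1 i) - bracket (M.hatK x₂.hat i) (M.traceK x₁.1 i)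
        - bracket (M.traceK x₁.1 i) (M.traceK x₂.1 i) := by
  have h := hΦ x₁.1 x₂.1 x₁.hat x₂.hat x₁.2.2.1.2.1 x₁.2.2.2.2.1 x₂.2.2.1.2.1 x₂.2.2.2.2.1 h₁ h₂ i
  rw [bracket_sub_sub] at h
  simp only [bracketHatK]
  linarith

/-- The broken space is a product over the subdomains, so the global symmetry can be tested on pairs
supported in one K. -/
theorem SourceSymmetric.local {I : Set ℝ} {f : M.Source} (h : M.SourceSymmetric I f) {t : ℝ}
    (ht : t ∈ I) (z w₁ w₂ : M.BW) (i : ι) :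
    Bold.ip (fderiv ℝ (f i t) (z.at' i) (w₁.at' i)) (M.valK w₂ i)
      = Bold.ip (M.valK w₁ i) (fderiv ℝ (f i t) (z.at' i) (w₂.at' i)) := by
  classical
  have h1 := h t ht z (M.restrictTo w₁ i) (M.restrictTo w₂ i)
  rw [Finset.sum_eq_single i, Finset.sum_eq_single i] at h1
  · rwa [restrictTo_at_self, restrictTo_at_self,
      M.valK_of_at_eq (M.restrictTo_at_self w₁ i),
      M.valK_of_at_eq (M.restrictTo_at_self w₂ i)] at h1
  · intro j _ hj
    rw [M.restrictTo_at_ne w₂ hj, map_zero, Bold.ip_zero]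
  · simp
  · intro j _ hj
    rw [M.restrictTo_at_ne w₁ hj, map_zero, Bold.zero_ip]
  · simp

end Linear

/-! ### The reduced equation, its variation and the local conservation law -/

section Reduction
variable {n : ℕ} {ι : Type*} [Fintype ι] {M : HybridFEEC n ι}
variable {Wt : Type*} [NormedAddCommGroup Wt] [InnerProductSpace ℝ Wt]
variable {I : Set ℝ} {f : M.Source} {Θ : ℝ → Bold Wt → M.State}

/-- Traces of variations come from the derivative of all of `Θ`, while `dz` differentiates z_h
alone; this makes the two compatible. -/
theorem fst_fderiv (hΘ : M.IsReduction I f Θ) {t : ℝ} (ht : t ∈ I) (z w : Bold Wt) :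
    (fderiv ℝ (Θ t) z w).1 = M.dz Θ t z w := by
  have h := ((hΘ.differentiable t ht) z).hasFDerivAt.fst
  rw [dz, h.fderiv]
  rfl


theorem hasFDerivAt_residual_comp (hf : M.SourceC1 I f) (hΘ : M.IsReduction I f Θ) {t : ℝ}
    (ht : t ∈ I) (z : Bold Wt) (w : M.BW) :
    ∃ D : Bold Wt →L[ℝ] ℝ, HasFDerivAt (fun y => M.residual f t (Θ t y) w) D z ∧
      ∀ v, D v = M.residualDeriv f t (Θ t z) (fderiv ℝ (Θ t) z v) w := by
  obtain ⟨D, hD, h⟩ := M.hasFDerivAt_residual hf ht (Θ t z) w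
  exact ⟨D ∘L fderiv ℝ (Θ t) z, HasFDerivAt.comp z hD ((hΘ.differentiable t ht) z).hasFDerivAt,
    fun v => h _⟩

variable [FiniteDimensional ℝ Wt] {L : Bold Wt →L[ℝ] M.BW}

/-- `𝐟̃` is differentiable if `z̃_h ↦ z_h` has a constant derivative. -/
theorem differentiable_fTilde (hf : M.SourceC1 I f) (hΘ : M.IsReduction I f Θ) {t : ℝ} (ht : t ∈ I)
    (hL : ∀ z, M.dz Θ t z = L) : Differentiable ℝ (M.fTilde f Θ t) := by
  -- With a constant derivative the test function L w̃ does not move with z, so the pairing is the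
  -- residual at a fixed test function.
  have hd : ∀ w : Bold Wt, Differentiable ℝ fun z => Bold.ip (M.fTilde f Θ t z) w := by
    intro w z
    obtain ⟨D, hD, -⟩ := hasFDerivAt_residual_comp hf hΘ ht z (L w)
    have h : (fun z => Bold.ip (M.fTilde f Θ t z) w) = fun y => M.residual f t (Θ t y) (L w) := by
      funext y
      rw [ip_fTilde, hL]
    rw [h]
    exact hD.differentiableAt
  -- The product `Bold Wt` does not carry a Hilbert norm, so each component is recovered from its
  -- own orthonormal coefficients.
  let b := stdOrthonormalBasis ℝ Wt
  have h1 : M.fTilde f Θ t = fun z =>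
      (∑ k, Bold.ip (M.fTilde f Θ t z) (b k, 0) • b k,
        ∑ k, Bold.ip (M.fTilde f Θ t z) (0, b k) • b k) := by
    funext z
    refine Prod.ext ?_ ?_
    · simp only [Bold.ip, inner_zero_right, add_zero]
      conv_lhs => rw [← b.sum_repr' (M.fTilde f Θ t z).1]
      simp only [real_inner_comm]
    · simp only [Bold.ip, inner_zero_right, zero_add]
      conv_lhs => rw [← b.sum_repr' (M.fTilde f Θ t z).2]
      simp only [real_inner_comm]
  rw [h1]
  exact (Differentiable.fun_sum fun k _ => (hd _).smul_const _).prodMk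
    (Differentiable.fun_sum fun k _ => (hd _).smul_const _)

theorem hasFDerivAt_field {t : ℝ} (h : Differentiable ℝ (M.fTilde f Θ t)) (z : Bold Wt) :
    HasFDerivAt (M.field f Θ t) (Bold.JinvL ∘L fderiv ℝ (M.fTilde f Θ t) z) z :=
  HasFDerivAt.comp z (Bold.JinvL (X := Wt)).hasFDerivAt (h z).hasFDerivAt

/-- The semidiscrete equation `(𝐉ż, w)_𝒯 = residual` holds for all test functions. -/
theorem sum_sympK_field (hΘ : M.IsReduction I f Θ) {t : ℝ} (ht : t ∈ I)
    (hL : ∀ z, M.dz Θ t z = L) (z : Bold Wt) (w : M.BW) :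
    ∑ i, M.sympK (L (M.field f Θ t z)) w i = M.residual f t (Θ t z) w := by
  -- For test functions from the reduced space the equation is the definition of 𝐟̃, by
  -- symplecticity and J J⁻¹ = 1; condition (b) extends it to all test functions.
  have h := hΘ.dynamics t ht z (M.field f Θ t z) (fun wt => by
    have h1 := M.ip_fTilde f Θ t z wt
    have h2 := hΘ.symplectic t ht z (M.field f Θ t z) wt
    rw [field, Bold.J_Jinv, h1] at h2
    simp only [residual, LinearMap.coe_mk, AddHom.coe_mk, Finset.sum_sub_distrib] at h2
    simp only [WeakDynamics, field]
    linarith) w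
  rw [hL] at h
  simp only [WeakDynamics] at h
  simp only [residual, LinearMap.coe_mk, AddHom.coe_mk, Finset.sum_sub_distrib]
  linarith

/-- `w ↦ (𝐉w, v)_K` is continuous and linear. -/
theorem sympK_eq_clm (v : M.BW) (i : ι) :
    ∃ A : M.BW →L[ℝ] ℝ, ∀ w, A w = M.sympK w v i :=
  ⟨-(Bold.ipL (Bold.J (M.valK v i)) ∘L M.valL i), fun w => by
    rw [sympK_symm, neg_apply, ContinuousLinearMap.comp_apply, Bold.ipL_apply, valL_apply,
      Bold.ip_comm]
    rfl⟩

/-- The variational equation holds for all test functions. -/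
theorem sum_sympK_variation (hf : M.SourceC1 I f) (hΘ : M.IsReduction I f Θ) {t : ℝ} (ht : t ∈ I)
    (hL : ∀ z, M.dz Θ t z = L) (z v : Bold Wt) (w : M.BW) :
    ∑ i, M.sympK (L (Bold.Jinv (fderiv ℝ (M.fTilde f Θ t) z v))) w i
      = M.residualDeriv f t (Θ t z) (fderiv ℝ (Θ t) z v) w := by
  obtain ⟨D, hD, h⟩ := hasFDerivAt_residual_comp hf hΘ ht z w
  choose A hA using fun i => sympK_eq_clm (M := M) w i
  -- The weak equation holds identically in the base point, with `w` and `L` fixed, so the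
  -- derivatives of its two sides coincide.
  have h1 : HasFDerivAt (fun y => ((∑ i, A i) ∘L L) (M.field f Θ t y)) _ z :=
    HasFDerivAt.comp z ((∑ i, A i) ∘L L).hasFDerivAt
      (hasFDerivAt_field (differentiable_fTilde hf hΘ ht hL) z)
  have h2 : (fun y => ((∑ i, A i) ∘L L) (M.field f Θ t y))
      = fun y => M.residual f t (Θ t y) w := by
    funext y
    rw [← sum_sympK_field hΘ ht hL y w]
    simp [hA]
  rw [h2] at h1
  rw [← h, hD.unique h1]
  simp only [ContinuousLinearMap.comp_apply, sum_apply, hA]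
  rfl

/-- The variational equation on a single subdomain. -/
theorem sympK_variation (hf : M.SourceC1 I f) (hΘ : M.IsReduction I f Θ) {t : ℝ} (ht : t ∈ I)
    (hL : ∀ z, M.dz Θ t z = L) (z v : Bold Wt) (w : M.BW) (i : ι) :
    M.sympK (L (Bold.Jinv (fderiv ℝ (M.fTilde f Θ t) z v))) w i
      = Bold.ip (fderiv ℝ (f i t) ((Θ t z).1.at' i) ((L v).at' i)) (M.valK w i)
        - Bold.ip (M.valK (L v) i) (M.diracK w i)
        - bracket (M.hatK (State.hat (fderiv ℝ (Θ t) z v)) i) (M.traceK w i) := by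
  classical
  -- Testing with w cut off to K leaves a single term in each sum.
  have h := sum_sympK_variation hf hΘ ht hL z v (M.restrictTo w i)
  rw [residualDeriv, Finset.sum_eq_single i, Finset.sum_eq_single i] at h
  · rw [sympK, M.valK_of_at_eq (M.restrictTo_at_self w i),
      M.diracK_of_at_eq (M.restrictTo_at_self w i),
      M.traceK_of_at_eq (M.restrictTo_at_self w i), fst_fderiv hΘ ht, hL] at h
    exact h
  · intro j _ hj
    have h0 := M.restrictTo_at_ne w hj
    rw [M.valK_of_at_eq_zero h0, M.diracK_of_at_eq_zero h0, M.traceK_of_at_eq_zero h0,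
      Bold.ip_zero, Bold.ip_zero, bracket_zero, sub_zero, sub_zero]
  · simp
  · intro j _ hj
    rw [sympK, M.valK_of_at_eq_zero (M.restrictTo_at_ne w hj), Bold.ip_zero]
  · simp

/-- The multisymplectic conservation law, in differential form: the rate of change of `(𝐉w₁, w₂)_K`
along variations is `-[ŵ₁, ŵ₂]_∂K`. -/
theorem sympK_variation_add (hf : M.SourceC1 I f) (hsymm : M.SourceSymmetric I f)
    (hΦ : M.MultisymplecticFlux) (hΘ : M.IsReduction I f Θ) {t : ℝ} (ht : t ∈ I)
    (hL : ∀ z, M.dz Θ t z = L) (z w₁ w₂ : Bold Wt) (i : ι) :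
    M.sympK (L (Bold.Jinv (fderiv ℝ (M.fTilde f Θ t) z w₁))) (L w₂) i
      + M.sympK (L w₁) (L (Bold.Jinv (fderiv ℝ (M.fTilde f Θ t) z w₂))) i
      = -M.fluxObs Θ i t z w₁ w₂ := by
  have hfl := M.fluxRelation_fderiv (hΘ.differentiable t ht) (hΘ.flux t ht) z
  have hb := M.bracketHatK_of_multisymplectic hΦ (hfl w₁) (hfl w₂) i
  rw [fst_fderiv hΘ ht, fst_fderiv hΘ ht, hL] at hb
  have h3 := M.ip_valK_diracK (L w₁) (L w₂) i
  have h4 := SourceSymmetric.local M hsymm ht (Θ t z).1 (L w₁) (L w₂) i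
  -- The symmetry `h4` cancels the source terms and `h3` turns the 𝐃 terms into [w₁, w₂]_∂K;
  -- together with the mixed brackets this is the right-hand side of `hb`, negated.
  rw [sympK_symm (L w₁), sympK_variation hf hΘ ht hL z w₁ (L w₂),
    sympK_variation hf hΘ ht hL z w₂ (L w₁), fluxObs, hb, h4, Bold.ip_comm (M.valK (L w₁) i)]
  linarith

/-- A linear map in finite dimension is its own derivative; independence of t makes one `L` serve
all stage times. -/
theorem IsLinearReduction.exists_dz (hlin : M.IsLinearReduction I Θ) (hΘ : M.IsReduction I f Θ)
    {t₀ : ℝ} (ht₀ : t₀ ∈ I) :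
    ∃ L : Bold Wt →L[ℝ] M.BW, (∀ z, (Θ t₀ z).1 = L z) ∧ ∀ t ∈ I, ∀ z, M.dz Θ t z = L := by
  refine ⟨LinearMap.toContinuousLinearMap (IsLinearMap.mk' _ (hlin t₀ ht₀)), fun z => rfl,
    fun t ht z => ?_⟩
  rw [dz, funext (hΘ.const t ht t₀ ht₀)]
  exact (LinearMap.toContinuousLinearMap (IsLinearMap.mk' _ (hlin t₀ ht₀))).fderiv

end Reduction

/-! ### Runge--Kutta steps for the augmented system -/

/-- Stage equations and updates share this shape: ℓ is the identity for a Runge–Kutta method and a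
coordinate projection for a partitioned one. -/
theorem hasFDerivAt_add_smul_sum {E V W : Type*} [NormedAddCommGroup E] [NormedSpace ℝ E]
    [NormedAddCommGroup V] [NormedSpace ℝ V] [NormedAddCommGroup W] [NormedSpace ℝ W] {s : ℕ}
    (ℓ : E →L[ℝ] V) (τ : ℝ) (α : Fin s → ℝ) {H : Fin s → W → V} {Y : Fin s → E → W}
    {A : Fin s → W →L[ℝ] V} {D : Fin s → E →L[ℝ] W} {z : E}
    (hH : ∀ j, HasFDerivAt (H j) (A j) (Y j z)) (hY : ∀ j, HasFDerivAt (Y j) (D j) z) :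
    HasFDerivAt (fun y => ℓ y + τ • ∑ j, α j • H j (Y j y))
      (ℓ + τ • ∑ j, α j • (A j ∘L D j)) z :=
  ℓ.hasFDerivAt.add ((HasFDerivAt.fun_sum fun j _ =>
    ((hH j).comp z (hY j)).const_smul (α j)).const_smul τ)

section Partitioned
variable {n : ℕ} {ι : Type*} {M : HybridFEEC n ι}
variable {Wt : Type*} [NormedAddCommGroup Wt] [InnerProductSpace ℝ Wt]
variable {I : Set ℝ} {Θ : ℝ → Bold Wt → M.State}

theorem IsPartitionedLinearReduction.isLinear (h : M.IsPartitionedLinearReduction I Θ) :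
    M.IsLinearReduction I Θ := by
  intro t ht
  obtain ⟨Lq, Lp, hLz⟩ := h t ht
  constructor
  · intro x y
    simp [hLz]
  · intro c x
    simp [hLz]

end Partitioned

/-! ### The symplectic form on K along numerical steps -/

section Steps
variable {n : ℕ} {ι : Type*} [Fintype ι] {M : HybridFEEC n ι}
variable {Wt : Type*} [NormedAddCommGroup Wt] [InnerProductSpace ℝ Wt]

/-- The bilinear form `(𝐉 L w₁, L w₂)_K`. -/
def sympForm (L : Bold Wt →L[ℝ] M.BW) (i : ι) : Bold Wt →ₗ[ℝ] Bold Wt →ₗ[ℝ] ℝ :=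
  LinearMap.mk₂ ℝ (fun w₁ w₂ => M.sympK (L w₁) (L w₂) i)
    (by
      obtain h := fun v => sympK_eq_clm (M := M) v i
      choose A hA using h
      intro w w' v
      rw [← hA, ← hA, ← hA, map_add, map_add])
    (by
      obtain h := fun v => sympK_eq_clm (M := M) v i
      choose A hA using h
      intro c w v
      rw [← hA, ← hA, map_smul, map_smul])
    (by
      obtain h := fun v => sympK_eq_clm (M := M) v i
      choose A hA using h
      intro w v v'
      -- Linearity in the second argument follows from the first by antisymmetry.
      rw [sympK_symm, sympK_symm _ (L v), sympK_symm _ (L v'), ← hA, ← hA, ← hA, map_add, map_add]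
      ring)
    (by
      obtain h := fun v => sympK_eq_clm (M := M) v i
      choose A hA using h
      intro c w v
      rw [sympK_symm, sympK_symm _ (L v), ← hA, ← hA, map_smul, map_smul, smul_neg])

theorem sympForm_apply (L : Bold Wt →L[ℝ] M.BW) (i : ι) (w₁ w₂ : Bold Wt) :
    sympForm L i w₁ w₂ = M.sympK (L w₁) (L w₂) i := rfl

/-- If `L` respects the splitting into `q` and `p`, then `(𝐉 L w₁, L w₂)_K` is the antisymmetrized
pairing of the `q`- and `p`-parts. -/
theorem sympForm_eq_of_partitioned {L : Bold Wt →L[ℝ] M.BW} (hq : ∀ q, (L (q, 0)).2 = 0)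
    (hp : ∀ p, (L (0, p)).1 = 0) (i : ι) (w₁ w₂ : Bold Wt) :
    sympForm L i w₁ w₂ = sympForm L i (w₁.1, 0) (0, w₂.2) - sympForm L i (w₂.1, 0) (0, w₁.2) := by
  have h1 : ∀ w : Bold Wt, w = (w.1, 0) + (0, w.2) := fun w => by simp
  -- J exchanges the components, so q pairs only with p.
  have hqq : ∀ q q', sympForm L i (q, 0) (q', 0) = 0 := fun q q' => by
    simp [sympForm_apply, sympK, valK, Bold.map, Bold.at', Bold.ip, Bold.J, hq]
  have hpp : ∀ p p', sympForm L i (0, p) (0, p') = 0 := fun p p' => by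
    simp [sympForm_apply, sympK, valK, Bold.map, Bold.at', Bold.ip, Bold.J, hp]
  have hqp : sympForm L i (0, w₁.2) (w₂.1, 0) = -sympForm L i (w₂.1, 0) (0, w₁.2) :=
    sympK_symm _ _ _
  conv_lhs => rw [h1 w₁, h1 w₂]
  simp only [map_add, LinearMap.add_apply, hqq, hpp, hqp]
  ring

variable {I : Set ℝ} {f : M.Source} {Θ : ℝ → Bold Wt → M.State} {L : Bold Wt →L[ℝ] M.BW}

theorem obs_eq_sympForm {t : ℝ} (hL : ∀ z, M.dz Θ t z = L) (i : ι) (z w₁ w₂ : Bold Wt) :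
    M.obs Θ i t z w₁ w₂ = sympForm L i w₁ w₂ := by
  rw [obs, hL, sympForm_apply]

variable [FiniteDimensional ℝ Wt]

/-- The w̃₁ and w̃₂ rows of the stages feed the bilinear identity, and the local law evaluates its
sum at each stage. The ζ row accumulates the same sum from the same initial value. -/
theorem rk_augmented_step (hf : M.SourceC1 I f) (hsymm : M.SourceSymmetric I f)
    (hΦ : M.MultisymplecticFlux) (hΘ : M.IsReduction I f Θ)
    (hL : ∀ t ∈ I, ∀ z, M.dz Θ t z = L) {t₀ Δt : ℝ} (ht₀ : t₀ ∈ I) (ht₁ : t₀ + Δt ∈ I) (i : ι)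
    {s : ℕ} {T : Tableau s} (hT : T.IsSymplectic) (hc : ∀ j, t₀ + T.c j * Δt ∈ I)
    {z₀ w₁ w₂ : Bold Wt} {Xs : Fin s → Aug Wt}
    (h : T.IsStages (M.augField f Θ i) t₀ Δt (z₀, w₁, w₂, M.obs Θ i t₀ z₀ w₁ w₂) Xs)
    {x₁ : Aug Wt}
    (hx : x₁ = T.step (M.augField f Θ i) t₀ Δt (z₀, w₁, w₂, M.obs Θ i t₀ z₀ w₁ w₂) Xs) :
    x₁.2.2.2 = M.obs Θ i (t₀ + Δt) x₁.1 x₁.2.1 x₁.2.2.1 ∧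
      M.obs Θ i (t₀ + Δt) x₁.1 x₁.2.1 x₁.2.2.1 = M.obs Θ i t₀ z₀ w₁ w₂
        - Δt * ∑ j, T.b j *
            M.fluxObs Θ i (t₀ + T.c j * Δt) (Xs j).1 (Xs j).2.1 (Xs j).2.2.1 := by
  have hQ := fun j => congrArg (fun x : Aug Wt => x.2.1) (h j)
  have hP := fun j => congrArg (fun x : Aug Wt => x.2.2.1) (h j)
  simp only [Prod.fst_add, Prod.snd_add, Prod.smul_fst, Prod.smul_snd, Prod.fst_sum, Prod.snd_sum,
    augField] at hQ hP
  have hB := hT.pair.bilinear_step (sympForm L i) Δt _ _ _ _ _ _ hQ hP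
  have hs := fun j => sympK_variation_add hf hsymm hΦ hΘ (hc j) (hL _ (hc j)) (Xs j).1
    (Xs j).2.1 (Xs j).2.2.1 i
  simp only [← sympForm_apply] at hs
  simp only [hs, mul_neg, Finset.sum_neg_distrib, ← sub_eq_add_neg] at hB
  have hmain : M.obs Θ i (t₀ + Δt) x₁.1 x₁.2.1 x₁.2.2.1 = M.obs Θ i t₀ z₀ w₁ w₂
      - Δt * ∑ j, T.b j *
          M.fluxObs Θ i (t₀ + T.c j * Δt) (Xs j).1 (Xs j).2.1 (Xs j).2.2.1 := by
    rw [obs_eq_sympForm (hL _ ht₁), obs_eq_sympForm (hL _ ht₀), ← hB, hx]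
    simp only [Tableau.step, Prod.fst_add, Prod.snd_add, Prod.smul_fst, Prod.smul_snd,
      Prod.fst_sum, Prod.snd_sum, augField]
  refine ⟨?_, hmain⟩
  rw [hmain, hx]
  simp only [Tableau.step, Prod.snd_add, Prod.smul_snd, Prod.snd_sum, augField, smul_eq_mul,
    mul_neg, Finset.sum_neg_distrib, ← sub_eq_add_neg]

/-- The bilinear identity for partitioned methods needs one argument from each part, hence the
splitting of the form into two q–p pairings. The local law concerns only their difference. -/
theorem prk_augmented_step (hf : M.SourceC1 I f) (hsymm : M.SourceSymmetric I f)
    (hΦ : M.MultisymplecticFlux) (hΘ : M.IsReduction I f Θ)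
    (hL : ∀ t ∈ I, ∀ z, M.dz Θ t z = L) (hq : ∀ q, (L (q, 0)).2 = 0)
    (hp : ∀ p, (L (0, p)).1 = 0) {t₀ Δt : ℝ} (ht₀ : t₀ ∈ I) (ht₁ : t₀ + Δt ∈ I) (i : ι)
    {s : ℕ} {T T' : Tableau s} (hT : T.IsSymplecticPair T') (hc : ∀ j, t₀ + T.c j * Δt ∈ I)
    {Fa : ℝ → (Wt × Wt × Wt × ℝ) → (Wt × Wt × Wt) → (Wt × Wt × Wt × ℝ)}
    {Ga : ℝ → (Wt × Wt × Wt × ℝ) → (Wt × Wt × Wt) → (Wt × Wt × Wt)}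
    (hFa : Fa = fun t x y => augFst (M.augField f Θ i t (augMk x y)))
    (hGa : Ga = fun t x y => augSnd (M.augField f Θ i t (augMk x y)))
    {z₀ w₁ w₂ : Bold Wt} {x₀ : Aug Wt} (hx₀ : x₀ = (z₀, w₁, w₂, M.obs Θ i t₀ z₀ w₁ w₂))
    {Xs : Fin s → Wt × Wt × Wt × ℝ} {Ys : Fin s → Wt × Wt × Wt}
    (h : T.IsPStages T' Fa Ga t₀ Δt (augFst x₀) (augSnd x₀) Xs Ys) {x₁ : Aug Wt}
    (hx : x₁ = augMk (T.pstep T' Fa Ga t₀ Δt (augFst x₀) (augSnd x₀) Xs Ys).1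
      (T.pstep T' Fa Ga t₀ Δt (augFst x₀) (augSnd x₀) Xs Ys).2) :
    x₁.2.2.2 = M.obs Θ i (t₀ + Δt) x₁.1 x₁.2.1 x₁.2.2.1 ∧
      M.obs Θ i (t₀ + Δt) x₁.1 x₁.2.1 x₁.2.2.1 = M.obs Θ i t₀ z₀ w₁ w₂
        - Δt * ∑ j, T.b j * M.fluxObs Θ i (t₀ + T.c j * Δt) (augMk (Xs j) (Ys j)).1
            (augMk (Xs j) (Ys j)).2.1 (augMk (Xs j) (Ys j)).2.2.1 := by
  subst hFa hGa hx₀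
  -- Equal nodes ensure that both parts evaluate the vector field at the same time.
  have hcc : ∀ j, T'.c j = T.c j := fun j => (hT.2.2 j).symm
  obtain ⟨hX, hY⟩ := h
  have hQ₁ := fun j => congrArg (fun x => x.2.1) (hX j)
  have hQ₂ := fun j => congrArg (fun x => x.2.2.1) (hX j)
  have hP₁ := fun j => congrArg (fun x => x.2.1) (hY j)
  have hP₂ := fun j => congrArg (fun x => x.2.2) (hY j)
  simp only [Prod.fst_add, Prod.snd_add, Prod.smul_fst, Prod.smul_snd, Prod.fst_sum, Prod.snd_sum,
    augField, augFst, augSnd, hcc] at hQ₁ hQ₂ hP₁ hP₂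
  let B : Wt →ₗ[ℝ] Wt →ₗ[ℝ] ℝ :=
    (sympForm L i).compl₁₂ (LinearMap.inl ℝ Wt Wt) (LinearMap.inr ℝ Wt Wt)
  have hform : ∀ v₁ v₂ : Bold Wt, sympForm L i v₁ v₂ = B v₁.1 v₂.2 - B v₂.1 v₁.2 :=
    sympForm_eq_of_partitioned hq hp i
  -- The first identity pairs the q part of w̃₁ with the p part of w̃₂, the second one the reverse.
  have hB₁ := hT.bilinear_step B Δt _ _ _ _ _ _ hQ₁ hP₂
  have hB₂ := hT.bilinear_step B Δt _ _ _ _ _ _ hQ₂ hP₁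
  have hs := fun j => sympK_variation_add hf hsymm hΦ hΘ (hc j) (hL _ (hc j))
    (augMk (Xs j) (Ys j)).1 (augMk (Xs j) (Ys j)).2.1 (augMk (Xs j) (Ys j)).2.2.1 i
  simp only [← sympForm_apply, hform] at hs
  have hsum : ∑ j, T.b j * M.fluxObs Θ i (t₀ + T.c j * Δt) (augMk (Xs j) (Ys j)).1
      (augMk (Xs j) (Ys j)).2.1 (augMk (Xs j) (Ys j)).2.2.1 = _ :=
    Finset.sum_congr rfl fun j _ => congrArg (T.b j * ·) (neg_eq_iff_eq_neg.mp (hs j).symm)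
  have hmain : M.obs Θ i (t₀ + Δt) x₁.1 x₁.2.1 x₁.2.2.1 = M.obs Θ i t₀ z₀ w₁ w₂
      - Δt * ∑ j, T.b j * M.fluxObs Θ i (t₀ + T.c j * Δt) (augMk (Xs j) (Ys j)).1
          (augMk (Xs j) (Ys j)).2.1 (augMk (Xs j) (Ys j)).2.2.1 := by
    rw [obs_eq_sympForm (hL _ ht₁), obs_eq_sympForm (hL _ ht₀), hsum, hform, hform, hx]
    simp only [Tableau.pstep, augMk, Prod.fst_add, Prod.snd_add, Prod.smul_fst, Prod.smul_snd,
      Prod.fst_sum, Prod.snd_sum, augField, augFst, augSnd, hcc] at hB₁ hB₂ ⊢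
    rw [hB₁, hB₂, add_sub_add_comm, ← mul_sub, ← Finset.sum_sub_distrib, sub_eq_add_neg _ (Δt * _),
      ← mul_neg, ← Finset.sum_neg_distrib]
    congr 2
    exact Finset.sum_congr rfl fun j _ => by ring
  refine ⟨?_, hmain⟩
  rw [hmain, hx]
  simp only [Tableau.pstep, augMk, augFst, Prod.snd_add, Prod.smul_snd, Prod.snd_sum, augField,
    smul_eq_mul, mul_neg, Finset.sum_neg_distrib, ← sub_eq_add_neg]

/-! ### Derivatives of the numerical flow -/

/-- Discretization commutes with linearization: the stage equations hold for all initial values near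
z₀, so they can be differentiated there, and the result is the method applied to the variational
equation. -/
theorem rk_variational_step (hf : M.SourceC1 I f) (hΘ : M.IsReduction I f Θ)
    (hL : ∀ t ∈ I, ∀ z, M.dz Θ t z = L) {t₀ Δt : ℝ}
    {s : ℕ} {T : Tableau s} (hc : ∀ j, t₀ + T.c j * Δt ∈ I) {z₀ : Bold Wt}
    {Z : Bold Wt → Fin s → Bold Wt} (h : ∀ᶠ z in 𝓝 z₀, T.IsStages (M.field f Θ) t₀ Δt z (Z z))
    (hZ : DifferentiableAt ℝ Z z₀) (w : Bold Wt) :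
    (∀ j, fderiv ℝ Z z₀ w j = w + Δt • ∑ k, T.a j k •
      Bold.Jinv (fderiv ℝ (M.fTilde f Θ (t₀ + T.c k * Δt)) (Z z₀ k) (fderiv ℝ Z z₀ w k))) ∧
    fderiv ℝ (fun z => T.step (M.field f Θ) t₀ Δt z (Z z)) z₀ w = w + Δt • ∑ k, T.b k •
      Bold.Jinv (fderiv ℝ (M.fTilde f Θ (t₀ + T.c k * Δt)) (Z z₀ k) (fderiv ℝ Z z₀ w k)) := by
  have hZj : ∀ j, HasFDerivAt (fun z => Z z j) (ContinuousLinearMap.proj j ∘L fderiv ℝ Z z₀) z₀ :=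
    fun j => hasFDerivAt_pi'.mp hZ.hasFDerivAt j
  have hH := fun j => hasFDerivAt_field (differentiable_fTilde hf hΘ (hc j) (hL _ (hc j))) (Z z₀ j)
  have hd := fun α : Fin s → ℝ =>
    hasFDerivAt_add_smul_sum (ContinuousLinearMap.id ℝ (Bold Wt)) Δt α hH hZj
  constructor
  · intro j
    have h1 := (hd (T.a j)).congr_of_eventuallyEq (f₁ := fun z => Z z j)
      (h.mono fun z hz => hz j)
    have h2 := DFunLike.congr_fun ((hZj j).unique h1) w
    simpa [Bold.JinvL, Bold.Jinv] using h2
  · have h1 : HasFDerivAt (fun z => T.step (M.field f Θ) t₀ Δt z (Z z)) _ z₀ := hd T.b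
    rw [h1.fderiv]
    simp [Bold.JinvL, Bold.Jinv]

theorem prk_variational_step (hf : M.SourceC1 I f) (hΘ : M.IsReduction I f Θ)
    (hL : ∀ t ∈ I, ∀ z, M.dz Θ t z = L) {t₀ Δt : ℝ}
    {s : ℕ} {T T' : Tableau s} (hcc : ∀ j, T'.c j = T.c j) (hc : ∀ j, t₀ + T.c j * Δt ∈ I)
    {F G : ℝ → Wt → Wt → Wt} (hF : F = fun t q p => (M.field f Θ t (q, p)).1)
    (hG : G = fun t q p => (M.field f Θ t (q, p)).2) {z₀ : Bold Wt} {Q P : Bold Wt → Fin s → Wt}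
    (h : ∀ᶠ z in 𝓝 z₀, T.IsPStages T' F G t₀ Δt z.1 z.2 (Q z) (P z))
    (hQ : DifferentiableAt ℝ Q z₀) (hP : DifferentiableAt ℝ P z₀) (w : Bold Wt)
    {W : Fin s → Bold Wt} (hW : W = fun j => (fderiv ℝ Q z₀ w j, fderiv ℝ P z₀ w j)) :
    (∀ j, (W j).1 = w.1 + Δt • ∑ k, T.a j k • (Bold.Jinv
      (fderiv ℝ (M.fTilde f Θ (t₀ + T.c k * Δt)) (Q z₀ k, P z₀ k) (W k))).1) ∧
    (∀ j, (W j).2 = w.2 + Δt • ∑ k, T'.a j k • (Bold.Jinv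
      (fderiv ℝ (M.fTilde f Θ (t₀ + T.c k * Δt)) (Q z₀ k, P z₀ k) (W k))).2) ∧
    fderiv ℝ (fun z : Bold Wt => T.pstep T' F G t₀ Δt z.1 z.2 (Q z) (P z)) z₀ w
      = (w.1 + Δt • ∑ k, T.b k • (Bold.Jinv
          (fderiv ℝ (M.fTilde f Θ (t₀ + T.c k * Δt)) (Q z₀ k, P z₀ k) (W k))).1,
        w.2 + Δt • ∑ k, T'.b k • (Bold.Jinv
          (fderiv ℝ (M.fTilde f Θ (t₀ + T.c k * Δt)) (Q z₀ k, P z₀ k) (W k))).2) := by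
  subst hF hG hW
  simp only [Tableau.IsPStages, Tableau.pstep, hcc] at h ⊢
  have hQj : ∀ j, HasFDerivAt (fun z => Q z j) (ContinuousLinearMap.proj j ∘L fderiv ℝ Q z₀) z₀ :=
    fun j => hasFDerivAt_pi'.mp hQ.hasFDerivAt j
  have hPj : ∀ j, HasFDerivAt (fun z => P z j) (ContinuousLinearMap.proj j ∘L fderiv ℝ P z₀) z₀ :=
    fun j => hasFDerivAt_pi'.mp hP.hasFDerivAt j
  have hZj := fun j => (hQj j).prodMk (hPj j)
  have hH := fun j => hasFDerivAt_field (differentiable_fTilde hf hΘ (hc j) (hL _ (hc j)))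
    (Q z₀ j, P z₀ j)
  have hdQ := fun α : Fin s → ℝ =>
    hasFDerivAt_add_smul_sum (ContinuousLinearMap.fst ℝ Wt Wt) Δt α (fun j => (hH j).fst) hZj
  have hdP := fun α : Fin s → ℝ =>
    hasFDerivAt_add_smul_sum (ContinuousLinearMap.snd ℝ Wt Wt) Δt α (fun j => (hH j).snd) hZj
  refine ⟨fun j => ?_, fun j => ?_, ?_⟩
  · have h1 := (hdQ (T.a j)).congr_of_eventuallyEq (f₁ := fun z => Q z j)
      (h.mono fun z hz => hz.1 j)
    have h2 := DFunLike.congr_fun ((hQj j).unique h1) w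
    simpa [Bold.JinvL, Bold.Jinv] using h2
  · have h1 := (hdP (T'.a j)).congr_of_eventuallyEq (f₁ := fun z => P z j)
      (h.mono fun z hz => hz.2 j)
    have h2 := DFunLike.congr_fun ((hPj j).unique h1) w
    simpa [Bold.JinvL, Bold.Jinv] using h2
  · have h1 := (hdQ T.b).prodMk (hdP T'.b)
    refine (DFunLike.congr_fun (HasFDerivAt.fderiv h1) w).trans ?_
    simp [Bold.JinvL, Bold.Jinv]

end Steps

end HybridFEEC
end MultisymplecticFEEC

end

/-! ### The discrete multisymplectic conservation law -/

open MultisymplecticFEEC HybridFEEC in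
theorem mainTheorem1 {n : ℕ} {ι : Type*} [Fintype ι] (M : HybridFEEC n ι)
    {Wt : Type*} [NormedAddCommGroup Wt] [InnerProductSpace ℝ Wt] [FiniteDimensional ℝ Wt]
    (I : Set ℝ) (f : M.Source) (Θ : ℝ → Bold Wt → M.State)
    (hf : M.SourceC1 I f) (hsymm : M.SourceSymmetric I f) (hΦ : M.MultisymplecticFlux)
    (hΘ : M.IsReduction I f Θ) (t₀ Δt : ℝ) (ht₀ : t₀ ∈ I) (ht₁ : t₀ + Δt ∈ I) (i : ι) (s : ℕ) :
    -- Runge--Kutta methods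
    (M.IsLinearReduction I Θ →
      ∀ T : Tableau s, T.IsSymplectic → (∀ j, t₀ + T.c j * Δt ∈ I) →
      -- every step of the method for the augmented system
      (∀ (z₀ w₁ w₂ : Bold Wt) (Xs : Fin s → Aug Wt),
        let x₀ : Aug Wt := (z₀, w₁, w₂, M.obs Θ i t₀ z₀ w₁ w₂)
        T.IsStages (M.augField f Θ i) t₀ Δt x₀ Xs →
        let x₁ := T.step (M.augField f Θ i) t₀ Δt x₀ Xs
        x₁.2.2.2 = M.obs Θ i (t₀ + Δt) x₁.1 x₁.2.1 x₁.2.2.1 ∧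
        M.obs Θ i (t₀ + Δt) x₁.1 x₁.2.1 x₁.2.2.1 = M.obs Θ i t₀ z₀ w₁ w₂
          - Δt * ∑ j, T.b j *
              M.fluxObs Θ i (t₀ + T.c j * Δt) (Xs j).1 (Xs j).2.1 (Xs j).2.2.1) ∧
      -- the steps whose variations are derivatives of the numerical flow `z ↦ Ψ z`
      (∀ (z₀ w₁ w₂ : Bold Wt) (Z : Bold Wt → Fin s → Bold Wt),
        (∀ᶠ z in 𝓝 z₀, T.IsStages (M.field f Θ) t₀ Δt z (Z z)) → DifferentiableAt ℝ Z z₀ →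
        let Ψ : Bold Wt → Bold Wt := fun z => T.step (M.field f Θ) t₀ Δt z (Z z)
        let z₁ := Ψ z₀
        let w₁' := fderiv ℝ Ψ z₀ w₁
        let w₂' := fderiv ℝ Ψ z₀ w₂
        let W₁ := fderiv ℝ Z z₀ w₁
        let W₂ := fderiv ℝ Z z₀ w₂
        let x₀ : Aug Wt := (z₀, w₁, w₂, M.obs Θ i t₀ z₀ w₁ w₂)
        (∃ ζ : Fin s → ℝ,
          let Xs : Fin s → Aug Wt := fun j => (Z z₀ j, W₁ j, W₂ j, ζ j)
          T.IsStages (M.augField f Θ i) t₀ Δt x₀ Xs ∧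
          (z₁, w₁', w₂', M.obs Θ i (t₀ + Δt) z₁ w₁' w₂')
            = T.step (M.augField f Θ i) t₀ Δt x₀ Xs) ∧
        M.obs Θ i (t₀ + Δt) z₁ w₁' w₂' = M.obs Θ i t₀ z₀ w₁ w₂
          - Δt * ∑ j, T.b j *
              M.fluxObs Θ i (t₀ + T.c j * Δt) (Z z₀ j) (W₁ j) (W₂ j))) ∧
    -- partitioned Runge--Kutta methods
    (M.IsPartitionedLinearReduction I Θ → M.FluxPartitions →
      ∀ T T' : Tableau s, T.IsSymplecticPair T' → (∀ j, t₀ + T.c j * Δt ∈ I) →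
      let F : ℝ → Wt → Wt → Wt := fun t q p => (M.field f Θ t (q, p)).1
      let G : ℝ → Wt → Wt → Wt := fun t q p => (M.field f Θ t (q, p)).2
      let Fa : ℝ → (Wt × Wt × Wt × ℝ) → (Wt × Wt × Wt) → (Wt × Wt × Wt × ℝ) :=
        fun t x y => augFst (M.augField f Θ i t (augMk x y))
      let Ga : ℝ → (Wt × Wt × Wt × ℝ) → (Wt × Wt × Wt) → (Wt × Wt × Wt) :=
        fun t x y => augSnd (M.augField f Θ i t (augMk x y))
      -- every step of the method for the augmented system
      (∀ (z₀ w₁ w₂ : Bold Wt) (Xs : Fin s → Wt × Wt × Wt × ℝ) (Ys : Fin s → Wt × Wt × Wt),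
        let x₀ : Aug Wt := (z₀, w₁, w₂, M.obs Θ i t₀ z₀ w₁ w₂)
        T.IsPStages T' Fa Ga t₀ Δt (augFst x₀) (augSnd x₀) Xs Ys →
        let x₁ : Aug Wt :=
          augMk (T.pstep T' Fa Ga t₀ Δt (augFst x₀) (augSnd x₀) Xs Ys).1
            (T.pstep T' Fa Ga t₀ Δt (augFst x₀) (augSnd x₀) Xs Ys).2
        let S : Fin s → Aug Wt := fun j => augMk (Xs j) (Ys j)
        x₁.2.2.2 = M.obs Θ i (t₀ + Δt) x₁.1 x₁.2.1 x₁.2.2.1 ∧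
        M.obs Θ i (t₀ + Δt) x₁.1 x₁.2.1 x₁.2.2.1 = M.obs Θ i t₀ z₀ w₁ w₂
          - Δt * ∑ j, T.b j *
              M.fluxObs Θ i (t₀ + T.c j * Δt) (S j).1 (S j).2.1 (S j).2.2.1) ∧
      -- the steps whose variations are derivatives of the numerical flow `z ↦ Ψ z`
      (∀ (z₀ w₁ w₂ : Bold Wt) (Q P : Bold Wt → Fin s → Wt),
        (∀ᶠ z in 𝓝 z₀, T.IsPStages T' F G t₀ Δt z.1 z.2 (Q z) (P z)) →
        DifferentiableAt ℝ Q z₀ → DifferentiableAt ℝ P z₀ →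
        let Ψ : Bold Wt → Bold Wt := fun z => T.pstep T' F G t₀ Δt z.1 z.2 (Q z) (P z)
        let z₁ := Ψ z₀
        let w₁' := fderiv ℝ Ψ z₀ w₁
        let w₂' := fderiv ℝ Ψ z₀ w₂
        let W₁ : Fin s → Bold Wt := fun j => (fderiv ℝ Q z₀ w₁ j, fderiv ℝ P z₀ w₁ j)
        let W₂ : Fin s → Bold Wt := fun j => (fderiv ℝ Q z₀ w₂ j, fderiv ℝ P z₀ w₂ j)
        let x₀ : Aug Wt := (z₀, w₁, w₂, M.obs Θ i t₀ z₀ w₁ w₂)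
        (∃ ζ : Fin s → ℝ,
          let S : Fin s → Aug Wt := fun j => ((Q z₀ j, P z₀ j), W₁ j, W₂ j, ζ j)
          let Xs := fun j => augFst (S j)
          let Ys := fun j => augSnd (S j)
          T.IsPStages T' Fa Ga t₀ Δt (augFst x₀) (augSnd x₀) Xs Ys ∧
          (z₁, w₁', w₂', M.obs Θ i (t₀ + Δt) z₁ w₁' w₂')
            = augMk (T.pstep T' Fa Ga t₀ Δt (augFst x₀) (augSnd x₀) Xs Ys).1
                (T.pstep T' Fa Ga t₀ Δt (augFst x₀) (augSnd x₀) Xs Ys).2) ∧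
        M.obs Θ i (t₀ + Δt) z₁ w₁' w₂' = M.obs Θ i t₀ z₀ w₁ w₂
          - Δt * ∑ j, T.b j *
              M.fluxObs Θ i (t₀ + T.c j * Δt) (Q z₀ j, P z₀ j) (W₁ j) (W₂ j))) := by
  refine ⟨fun hlin T hT hc => ?_, fun hpart _ T T' hT hc => ?_⟩
  · obtain ⟨L, -, hL⟩ := hlin.exists_dz hΘ ht₀
    constructor
    · intro z₀ w₁ w₂ Xs x₀ h
      exact rk_augmented_step hf hsymm hΦ hΘ hL ht₀ ht₁ i hT hc h rfl
    intro z₀ w₁ w₂ Z hZ hZd Ψ z₁ w₁' w₂' W₁ W₂ x₀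
    obtain ⟨hW₁, hw₁⟩ := rk_variational_step hf hΘ hL hc hZ hZd w₁
    obtain ⟨hW₂, hw₂⟩ := rk_variational_step hf hΘ hL hc hZ hZd w₂
    -- The slope of ζ depends only on the other stages, so its stage equations are solved by their
    -- own right-hand side.
    let ζ : Fin s → ℝ := fun j => M.obs Θ i t₀ z₀ w₁ w₂ + Δt * ∑ k, T.a j k *
      -M.fluxObs Θ i (t₀ + T.c k * Δt) (Z z₀ k) (W₁ k) (W₂ k)
    have hst : T.IsStages (M.augField f Θ i) t₀ Δt x₀
        (fun j => (Z z₀ j, W₁ j, W₂ j, ζ j)) := by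
      intro j
      refine Prod.ext ?_ (Prod.ext ?_ (Prod.ext ?_ ?_)) <;>
        simp only [Prod.fst_add, Prod.snd_add, Prod.smul_fst, Prod.smul_snd, Prod.fst_sum,
          Prod.snd_sum, augField, x₀]
      · exact hZ.self_of_nhds j
      · exact hW₁ j
      · exact hW₂ j
      · rfl
    obtain ⟨h1, h2⟩ := rk_augmented_step hf hsymm hΦ hΘ hL ht₀ ht₁ i hT hc hst rfl
    -- Once these components are identified, the ζ component and the law both come from the result
    -- for augmented steps.
    have e : ((z₁, w₁', w₂') : Bold Wt × Bold Wt × Bold Wt) =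
        ((T.step (M.augField f Θ i) t₀ Δt x₀ (fun j => (Z z₀ j, W₁ j, W₂ j, ζ j))).1,
          (T.step (M.augField f Θ i) t₀ Δt x₀ (fun j => (Z z₀ j, W₁ j, W₂ j, ζ j))).2.1,
          (T.step (M.augField f Θ i) t₀ Δt x₀ (fun j => (Z z₀ j, W₁ j, W₂ j, ζ j))).2.2.1) := by
      refine Prod.ext ?_ (Prod.ext ?_ ?_) <;>
        simp only [Tableau.step, Prod.fst_add, Prod.snd_add, Prod.smul_fst, Prod.smul_snd,
          Prod.fst_sum, Prod.snd_sum, augField, x₀]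
      · rfl
      · exact hw₁
      · exact hw₂
    simp only [Prod.mk.injEq] at e
    obtain ⟨e1, e2, e3⟩ := e
    rw [e1, e2, e3]
    refine ⟨⟨ζ, hst, ?_⟩, h2⟩
    rw [← h1]
  · obtain ⟨L, hLz, hL⟩ := hpart.isLinear.exists_dz hΘ ht₀
    obtain ⟨Lq, Lp, hqp⟩ := hpart t₀ ht₀
    -- The splitting is needed only at t₀, since the same `L` serves all times in `I`.
    have hq : ∀ q, (L (q, 0)).2 = 0 := fun q => by rw [← hLz, hqp, map_zero]
    have hp : ∀ p, (L (0, p)).1 = 0 := fun p => by rw [← hLz, hqp, map_zero]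
    intro F G Fa Ga
    constructor
    · intro z₀ w₁ w₂ Xs Ys x₀ h
      exact prk_augmented_step hf hsymm hΦ hΘ hL hq hp ht₀ ht₁ i hT hc rfl rfl rfl h rfl
    intro z₀ w₁ w₂ Q P hQP hQ hP Ψ z₁ w₁' w₂' W₁ W₂ x₀
    have hcc : ∀ j, T'.c j = T.c j := fun j => (hT.2.2 j).symm
    obtain ⟨hq₁, hp₁, hw₁⟩ := prk_variational_step hf hΘ hL hcc hc rfl rfl hQP hQ hP w₁
      (W := W₁) rfl
    obtain ⟨hq₂, hp₂, hw₂⟩ := prk_variational_step hf hΘ hL hcc hc rfl rfl hQP hQ hP w₂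
      (W := W₂) rfl
    -- As before, these stages are explicit; ζ belongs to the first part and therefore uses the
    -- coefficients of `T`.
    let ζ : Fin s → ℝ := fun j => M.obs Θ i t₀ z₀ w₁ w₂ + Δt * ∑ k, T.a j k *
      -M.fluxObs Θ i (t₀ + T.c k * Δt) (Q z₀ k, P z₀ k) (W₁ k) (W₂ k)
    let S : Fin s → Aug Wt := fun j => ((Q z₀ j, P z₀ j), W₁ j, W₂ j, ζ j)
    have hst : T.IsPStages T' Fa Ga t₀ Δt (augFst x₀) (augSnd x₀) (fun j => augFst (S j))
        (fun j => augSnd (S j)) := by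
      have h0 := hQP.self_of_nhds
      constructor
      · intro j
        refine Prod.ext ?_ (Prod.ext ?_ (Prod.ext ?_ ?_)) <;>
          simp only [Prod.fst_add, Prod.snd_add, Prod.smul_fst, Prod.smul_snd, Prod.fst_sum,
            Prod.snd_sum, augField, augFst, augSnd, augMk, x₀, Fa, S]
        · exact h0.1 j
        · exact hq₁ j
        · exact hq₂ j
        · rfl
      · intro j
        refine Prod.ext ?_ (Prod.ext ?_ ?_) <;>
          simp only [Prod.fst_add, Prod.snd_add, Prod.smul_fst, Prod.smul_snd, Prod.fst_sum,
            Prod.snd_sum, augField, augFst, augSnd, augMk, x₀, Ga, S]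
        · exact h0.2 j
        · simpa only [hcc] using hp₁ j
        · simpa only [hcc] using hp₂ j
    obtain ⟨h1, h2⟩ := prk_augmented_step hf hsymm hΦ hΘ hL hq hp ht₀ ht₁ i hT hc rfl rfl
      (x₀ := x₀) rfl hst rfl
    set x₁ : Aug Wt := augMk
      (T.pstep T' Fa Ga t₀ Δt (augFst x₀) (augSnd x₀) (fun j => augFst (S j))
        (fun j => augSnd (S j))).1
      (T.pstep T' Fa Ga t₀ Δt (augFst x₀) (augSnd x₀) (fun j => augFst (S j))
        (fun j => augSnd (S j))).2 with hx₁
    have e1 : z₁ = x₁.1 := by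
      rw [hx₁]
      simp only [Tableau.pstep, Prod.fst_add, Prod.smul_fst, Prod.fst_sum, augField, augFst,
        augSnd, augMk, x₀, Fa, Ga, S]
      rfl
    have e2 : w₁' = x₁.2.1 := by
      refine hw₁.trans ?_
      rw [hx₁]
      simp only [Tableau.pstep, Prod.fst_add, Prod.snd_add, Prod.smul_fst, Prod.smul_snd,
        Prod.fst_sum, Prod.snd_sum, augField, augFst, augSnd, augMk, x₀, Fa, Ga, S, hcc]
    have e3 : w₂' = x₁.2.2.1 := by
      refine hw₂.trans ?_
      rw [hx₁]
      simp only [Tableau.pstep, Prod.fst_add, Prod.snd_add, Prod.smul_fst, Prod.smul_snd,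
        Prod.fst_sum, Prod.snd_sum, augField, augFst, augSnd, augMk, x₀, Fa, Ga, S, hcc]
    rw [e1, e2, e3]
    refine ⟨⟨ζ, hst, ?_⟩, h2⟩
    rw [← h1]
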